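/- Consider Minkowski space-time with inertial coordinates $(t,x^1,x^2,x^3)$, metric $g=\mathrm{diag}(-1,1,1,1)$ and $r=\sqrt{(x^1)^2+(x^2)^2+(x^3)^2}$. Let $U$ be a connected open set and let $u$ be a vector field on $U$. Call $u$ a *radial conformally stationary congruence* on $U$ if it is a smooth future-directed unit time-like field whose spatial part is at every point proportional to the position vector $(x^1,x^2,x^3)$ (for $r>0$: $u=\cosh\phi\,\partial_t+\sinh\phi\,\partial_r$), and if $u=\xi/|\xi|$ for a smooth time-like conformal Killing vector field $\xi$ on $U$, where $|\xi|=\sqrt{-g(\xi,\xi)}$. Let $\theta=\nabla\cdot u$ be its expansion. Say that $u$ is *the flow of a classical ideal gas* with constants $k>0$, $c_v>0$ if $u$ is a smooth future-directed unit time-like field on $U$ and there are smooth functions $\rho,p,n,\epsilon,s,\Theta$ on $U$ with $$\nabla\cdot\big[(\rho+p)\,u\otimes u+p\,g\big]=0,\quad \rho=n(1+\epsilon),\quad \nabla\cdot(nu)=0,\quad \Theta\,ds=d\epsilon+p\,d(1/n),\quad p=kn\Theta>0,\quad \epsilon=c_v\Theta .$$ For $t_0\in\mathbb{R}$, the *Milne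 congruence* from the event $(t_0,0,0,0)$ is $$u=\frac{(t-t_0)\,\partial_t+r\,\partial_r}{\sqrt{(t-t_0)^2-r^2}}\qquad\text{on } t-t_0>r ,$$ and the *contracting Milne congruence* is the negative of the same expression on $t_0-t>r$ (in both cases $\tanh\phi=r/(t-t_0)$). Then: 1. $u$ is a radial conformally stationary congruence with $\theta>0$ on $U$ and is the flow of a classical ideal gas (for some $k,c_v>0$) if, and only if, there is a $t_0$ such that $U\subset\{t-t_0>r\}$ and $u$ is the Milne congruence from $(t_0,0,0,0)$ on $U$. 2. The same holds with $\theta\neq0$ everywhere on $U$ in place of $\theta>0$, if contracting Milne congruences (with $U\subset\{t_0-t>r\}$) are allowed as well. 3. Every Milne congruence, expanding or contracting, is the flow of a classical ideal gas for all values of $k>0$ and $c_v>0$, with $n>0$ and $\Theta>0$. -/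

import Mathlib

open scoped ContDiff

noncomputable section

/-- Minkowski space-time in inertial coordinates `(t, x¹, x², x³)`; `x 0` is the time `t`. -/
abbrev Spacetime : Type := Fin 4 → ℝ

namespace Minkowski

/-- The Minkowski metric `diag(-1, 1, 1, 1)`, which as a matrix is its own inverse; so it stands
for both the covariant components `g_{μν}` and the contravariant components `g^{μν}`. -/
def eta : Matrix (Fin 4) (Fin 4) ℝ := Matrix.diagonal ![-1, 1, 1, 1]

/-- The product `g(v, w) = g_{μν} v^μ w^ν`. -/
def metric (v w : Fin 4 → ℝ) : ℝ := ∑ μ, ∑ ν, eta μ ν * v μ * w ν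

/-- The modulus `|v| = √(-g(v, v))` of a time-like vector. -/
def modulus (v : Fin 4 → ℝ) : ℝ := Real.sqrt (-metric v v)

/-- The radial coordinate `r` of the inertial spherical coordinates `(t, r, ϑ, φ)`. -/
def radius (x : Spacetime) : ℝ := Real.sqrt (x 1 ^ 2 + x 2 ^ 2 + x 3 ^ 2)

/-- The partial derivative `∂_μ f`. In inertial coordinates the connection coefficients vanish,
so that this is also the covariant derivative of components. -/
def pd (μ : Fin 4) (f : Spacetime → ℝ) (x : Spacetime) : ℝ := fderiv ℝ f x (Pi.single μ 1)

/-- The divergence `∇ · X = ∂_μ X^μ`. -/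
def divergence (X : Spacetime → Fin 4 → ℝ) (x : Spacetime) : ℝ :=
  ∑ μ, pd μ (fun y => X y μ) x

/-- The expansion `θ = ∇ · u` of a unit vector field. -/
def expansion (u : Spacetime → Fin 4 → ℝ) (x : Spacetime) : ℝ := divergence u x

/-- Components of the Lie derivative of the metric,
`(L_ξ g)_{μν} = g_{αν} ∂_μ ξ^α + g_{μα} ∂_ν ξ^α`
(the term `ξ^α ∂_α g_{μν}` vanishes in inertial coordinates). -/
def lieMetric (ξ : Spacetime → Fin 4 → ℝ) (x : Spacetime) (μ ν : Fin 4) : ℝ :=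
  ∑ α, (eta α ν * pd μ (fun y => ξ y α) x + eta μ α * pd ν (fun y => ξ y α) x)

/-- `ξ` is a (smooth) conformal Killing vector field on `U`: `L_ξ g = 2 l g` for a function `l`. -/
def IsConformalKilling (ξ : Spacetime → Fin 4 → ℝ) (U : Set Spacetime) : Prop :=
  ContDiffOn ℝ ∞ ξ U ∧
    ∃ l : Spacetime → ℝ, ∀ x ∈ U, ∀ μ ν, lieMetric ξ x μ ν = 2 * l x * eta μ ν

/-- `u` is a smooth future-directed unit time-like vector field on `U`. -/
def IsUnitVelocity (u : Spacetime → Fin 4 → ℝ) (U : Set Spacetime) : Prop :=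
  ContDiffOn ℝ ∞ u U ∧ ∀ x ∈ U, metric (u x) (u x) = -1 ∧ 0 < u x 0

/-- `u` is radial: `u` lies in the plane of `∂_t` and `∂_r`, that is, its spatial part is
proportional to the spatial position vector `(x¹, x², x³)`. For a future-directed unit `u` and
`r > 0` this says `u = cosh φ ∂_t + sinh φ ∂_r`; for `r = 0` it says `u = ∂_t`. -/
def IsRadial (u : Spacetime → Fin 4 → ℝ) (U : Set Spacetime) : Prop :=
  ∀ x ∈ U, ∃ b : ℝ, ∀ i : Fin 3, u x i.succ = b * x i.succ

/-- `u` is conformally stationary: `u = ξ / |ξ|` for a time-like conformal Killing vector `ξ`. -/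
def IsConformallyStationary (u : Spacetime → Fin 4 → ℝ) (U : Set Spacetime) : Prop :=
  ∃ ξ : Spacetime → Fin 4 → ℝ, IsConformalKilling ξ U ∧
    ∀ x ∈ U, metric (ξ x) (ξ x) < 0 ∧ u x = (modulus (ξ x))⁻¹ • ξ x

/-- A radial conformally stationary congruence on `U`, given by its unit velocity `u`. -/
def IsRadialConformallyStationary (u : Spacetime → Fin 4 → ℝ) (U : Set Spacetime) : Prop :=
  IsUnitVelocity u U ∧ IsRadial u U ∧ IsConformallyStationary u U

/-- The energy tensor `T^{μν} = (ρ + p) u^μ u^ν + p g^{μν}` of a perfect fluid. -/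
def energyTensor (u : Spacetime → Fin 4 → ℝ) (ρ p : Spacetime → ℝ) (x : Spacetime)
    (μ ν : Fin 4) : ℝ :=
  (ρ x + p x) * u x μ * u x ν + p x * eta μ ν

/-- The fundamental system of the hydrodynamics of a classical ideal gas with constants
`k = k_B / m` and `c_v`, on `U`: `u` is the unit velocity, `ρ` the energy density, `p` the
pressure, `n` the matter density, `ε` the specific internal energy, `s` the specific entropy and
`Θ` the temperature. -/
structure IsClassicalIdealGas (k cv : ℝ) (u : Spacetime → Fin 4 → ℝ)
    (ρ p n ε s Θ : Spacetime → ℝ) (U : Set Spacetime) : Prop where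
  k_pos : 0 < k
  cv_pos : 0 < cv
  unit_velocity : IsUnitVelocity u U
  smooth_rho : ContDiffOn ℝ ∞ ρ U
  smooth_p : ContDiffOn ℝ ∞ p U
  smooth_n : ContDiffOn ℝ ∞ n U
  smooth_eps : ContDiffOn ℝ ∞ ε U
  smooth_s : ContDiffOn ℝ ∞ s U
  smooth_temp : ContDiffOn ℝ ∞ Θ U
  /-- Conservation of energy and momentum, `∇ · T = 0`. -/
  conservation : ∀ x ∈ U, ∀ ν, ∑ μ, pd μ (fun y => energyTensor u ρ p y μ ν) x = 0
  /-- Decomposition of the energy density, `ρ = n (1 + ε)`. -/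
  decomposition : ∀ x ∈ U, ρ x = n x * (1 + ε x)
  /-- Conservation of matter, `∇ · (n u) = 0`. -/
  matter : ∀ x ∈ U, divergence (fun y => n y • u y) x = 0
  /-- Local thermal equilibrium, `Θ ds = dε + p d(1/n)`. -/
  lte : ∀ x ∈ U, ∀ μ, Θ x * pd μ s x = pd μ ε x + p x * pd μ (fun y => (n y)⁻¹) x
  /-- The equations of state `p = k n Θ > 0` and `ε = c_v Θ`. -/
  state_p : ∀ x ∈ U, p x = k * n x * Θ x
  p_pos : ∀ x ∈ U, 0 < p x
  state_eps : ∀ x ∈ U, ε x = cv * Θ x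

/-- `u` is, on `U`, the flow of some classical ideal gas. -/
def IsCIGFlow (u : Spacetime → Fin 4 → ℝ) (U : Set Spacetime) : Prop :=
  ∃ (k cv : ℝ) (ρ p n ε s Θ : Spacetime → ℝ), IsClassicalIdealGas k cv u ρ p n ε s Θ U

/-- The vector `(t - t₀) ∂_t + r ∂_r` from the event `(t₀, 0, 0, 0)` to the event `x`. -/
def positionFrom (t₀ : ℝ) (x : Spacetime) : Fin 4 → ℝ := x - Pi.single 0 t₀

/-- `u` is, on `U`, the (expanding) Milne congruence issuing from the event `(t₀, 0, 0, 0)`: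
`U` lies in the interior `t - t₀ > r` of its future light cone, and there
`u = ((t - t₀) ∂_t + r ∂_r) / √((t - t₀)² - r²)`, that is, `tanh φ = r / (t - t₀)`. -/
def IsMilne (t₀ : ℝ) (u : Spacetime → Fin 4 → ℝ) (U : Set Spacetime) : Prop :=
  ∀ x ∈ U, radius x < x 0 - t₀ ∧
    u x = (Real.sqrt ((x 0 - t₀) ^ 2 - radius x ^ 2))⁻¹ • positionFrom t₀ x

/-- The time reverse of a Milne congruence: `U` lies in the interior `t₀ - t > r` of the past
light cone of `(t₀, 0, 0, 0)`, and again `tanh φ = r / (t - t₀)`, `u` being future-directed. -/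
def IsContractingMilne (t₀ : ℝ) (u : Spacetime → Fin 4 → ℝ) (U : Set Spacetime) : Prop :=
  ∀ x ∈ U, radius x < t₀ - x 0 ∧
    u x = -((Real.sqrt ((x 0 - t₀) ^ 2 - radius x ^ 2))⁻¹ • positionFrom t₀ x)

end Minkowski

end

noncomputable section

namespace Minkowski

/-! Write v for the covariant components of u = ξ/|ξ|, ψ = log |ξ| and H = θ/3. The conformal
Killing equation fixes the symmetric part of ∂v in terms of H and dψ
(`IsConformallyStationary.isShearFree`), and radial symmetry removes the rotation, so that ∂_μ v_ν =
H η_{μν} - v_μ ∂_ν ψ off the axis (`IsShearFree.pd_eq_of_radial`). Flatness, i.e. commuting second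
derivatives of v, then makes dH parallel to v (`IsShearFree.exists_pd_H`).

The gas enters through the exactness of d log p. Its curl, contracted with u, says that a function
affine in 1/Θ times the acceleration a = dψ + H v vanishes. Where a ≠ 0 the temperature would thus
be locally constant, whereas the energy equation gives u(1/Θ) = (3k/c_v) H/Θ ≠ 0. So a = 0
(`IsClassicalIdealGas.acceleration_eq_zero`). With a = 0 the expansion satisfies dH = H² v, hence x
- u/H has zero derivative: all flow lines are straight and pass through one event, which radiality
places on the axis (`exists_eq_smul_positionFrom`). The sign of H selects the expanding or the
contracting Milne congruence.

Conversely, powers of the proper time τ from that event solve the gas equations explicitly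
(`IsSignedMilne.isClassicalIdealGas`). -/

/-- `f` is differentiable at `x` with partial derivatives `f'`. -/
def HasPd (f : Spacetime → ℝ) (f' : Fin 4 → ℝ) (x : Spacetime) : Prop :=
  DifferentiableAt ℝ f x ∧ ∀ μ, pd μ f x = f' μ

/-! ### Calculus of partial derivatives on space-time. -/

section Calculus

variable {f g : Spacetime → ℝ} {f' g' : Fin 4 → ℝ} {x : Spacetime} {U : Set Spacetime}

lemma _root_.DifferentiableAt.hasPd (h : DifferentiableAt ℝ f x) :
    HasPd f (fun μ => pd μ f x) x :=
  ⟨h, fun _ => rfl⟩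

lemma HasPd.add (hf : HasPd f f' x) (hg : HasPd g g' x) :
    HasPd (fun y => f y + g y) (fun μ => f' μ + g' μ) x :=
  ⟨hf.1.add hg.1, fun μ => by
    beta_reduce; rw [pd, fderiv_fun_add hf.1 hg.1, ← hf.2, ← hg.2]; rfl⟩

lemma HasPd.sub (hf : HasPd f f' x) (hg : HasPd g g' x) :
    HasPd (fun y => f y - g y) (fun μ => f' μ - g' μ) x :=
  ⟨hf.1.sub hg.1, fun μ => by
    beta_reduce; rw [pd, fderiv_fun_sub hf.1 hg.1, ← hf.2, ← hg.2]; rfl⟩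

lemma HasPd.mul (hf : HasPd f f' x) (hg : HasPd g g' x) :
    HasPd (fun y => f y * g y) (fun μ => f' μ * g x + f x * g' μ) x :=
  ⟨hf.1.mul hg.1, fun μ => by
    beta_reduce; rw [pd, fderiv_fun_mul hf.1 hg.1, ← hf.2, ← hg.2]
    simp [pd]; ring⟩

lemma hasPd_const (c : ℝ) : HasPd (fun _ => c) (fun _ => 0) x :=
  ⟨differentiableAt_const c, fun μ => by simp [pd]⟩

lemma HasPd.const_mul (c : ℝ) (hf : HasPd f f' x) :
    HasPd (fun y => c * f y) (fun μ => c * f' μ) x := by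
  simpa using (hasPd_const c).mul hf

lemma hasPd_coord (ν : Fin 4) : HasPd (fun y => y ν) (fun μ => if μ = ν then 1 else 0) x :=
  ⟨differentiableAt_apply ν x, fun μ => by
    have h : HasFDerivAt (fun y : Spacetime => y ν)
      (ContinuousLinearMap.proj (R := ℝ) (φ := fun _ : Fin 4 => ℝ) ν) x := hasFDerivAt_apply ν x
    rw [pd, h.fderiv]
    simp [Pi.single_apply, eq_comm]⟩

/-- Chain rule for a function of one variable. -/
lemma HasPd.comp {F : ℝ → ℝ} {F' : ℝ} (hF : HasDerivAt F F' (f x)) (hf : HasPd f f' x) :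
    HasPd (fun y => F (f y)) (fun μ => F' * f' μ) x := by
  have h := hF.comp_hasFDerivAt x hf.1.hasFDerivAt
  refine ⟨h.differentiableAt, fun μ => ?_⟩
  beta_reduce
  rw [← hf.2, pd, pd]
  exact congrArg (fun A : Spacetime →L[ℝ] ℝ => A (Pi.single μ 1)) h.fderiv

lemma HasPd.inv (hf : HasPd f f' x) (h0 : f x ≠ 0) :
    HasPd (fun y => (f y)⁻¹) (fun μ => -(f x ^ 2)⁻¹ * f' μ) x :=
  hf.comp (hasDerivAt_inv h0)

lemma HasPd.log (hf : HasPd f f' x) (h0 : f x ≠ 0) :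
    HasPd (fun y => Real.log (f y)) (fun μ => (f x)⁻¹ * f' μ) x :=
  hf.comp (Real.hasDerivAt_log h0)

lemma HasPd.sum {ι : Type*} (s : Finset ι) {F : ι → Spacetime → ℝ} {F' : ι → Fin 4 → ℝ}
    (h : ∀ i ∈ s, HasPd (F i) (F' i) x) :
    HasPd (fun y => ∑ i ∈ s, F i y) (fun μ => ∑ i ∈ s, F' i μ) x := by
  classical
  induction s using Finset.induction_on with
  | empty => simpa using hasPd_const 0
  | insert a s ha ih =>
    simp only [Finset.sum_insert ha]
    exact (h a (by simp)).add (ih fun i hi => h i (by simp [hi]))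

lemma pd_congr (hU : IsOpen U) (hx : x ∈ U) (h : ∀ y ∈ U, f y = g y) (μ : Fin 4) :
    pd μ f x = pd μ g x := by
  have : f =ᶠ[nhds x] g := Filter.eventuallyEq_of_mem (hU.mem_nhds hx) h
  rw [pd, this.fderiv_eq, pd]

lemma HasPd.congr (hU : IsOpen U) (hx : x ∈ U) (h : ∀ y ∈ U, f y = g y) (hg : HasPd g g' x) :
    HasPd f g' x :=
  ⟨hg.1.congr_of_eventuallyEq (Filter.eventuallyEq_of_mem (hU.mem_nhds hx) h),
    fun μ => (pd_congr hU hx h μ).trans (hg.2 μ)⟩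

lemma hasPd_of_contDiffOn (hf : ContDiffOn ℝ ∞ f U) (hU : IsOpen U) (hx : x ∈ U) :
    HasPd f (fun μ => pd μ f x) x :=
  ((hf.contDiffAt (hU.mem_nhds hx)).differentiableAt (by simp)).hasPd

lemma contDiffOn_pd (hf : ContDiffOn ℝ ∞ f U) (hU : IsOpen U) (μ : Fin 4) :
    ContDiffOn ℝ ∞ (pd μ f) U :=
  (hf.fderiv_of_isOpen hU (m := ∞) (by simp)).clm_apply contDiffOn_const

lemma pd_comm (hf : ContDiffOn ℝ ∞ f U) (hU : IsOpen U) (hx : x ∈ U) (μ ν : Fin 4) :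
    pd μ (pd ν f) x = pd ν (pd μ f) x := by
  have hc := hf.contDiffAt (hU.mem_nhds hx)
  have hs : IsSymmSndFDerivAt ℝ f x := hc.isSymmSndFDerivAt (by
    rw [minSmoothness_of_isRCLikeNormedField]
    exact WithTop.coe_le_coe.2 (le_top : (2 : ℕ∞) ≤ ⊤))
  have hd : DifferentiableAt ℝ (fderiv ℝ f) x :=
    ((hf.fderiv_of_isOpen hU (m := ∞) (by simp)).contDiffAt (hU.mem_nhds hx)).differentiableAt
      (by simp)
  have key : ∀ a b : Fin 4, pd a (pd b f) x =
      fderiv ℝ (fderiv ℝ f) x (Pi.single a 1) (Pi.single b 1) := by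
    intro a b
    have : fderiv ℝ (pd b f) x =
        (fderiv ℝ (fderiv ℝ f) x).flip (Pi.single b 1) := by
      have := fderiv_clm_apply hd (differentiableAt_const (Pi.single b (1 : ℝ) : Spacetime))
      change fderiv ℝ (fun y => fderiv ℝ f y (Pi.single b 1)) x = _
      simpa using this
    rw [pd, this]; rfl
  rw [key, key, hs.eq]

/-- A function whose partial derivatives vanish on a preconnected open set is constant there. -/
lemma exists_const_of_pd_eq_zero (hU : IsOpen U) (hconn : IsPreconnected U)
    (hf : ∀ x ∈ U, HasPd f (fun _ => 0) x) : ∃ c, ∀ x ∈ U, f x = c := by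
  refine hU.exists_is_const_of_fderiv_eq_zero hconn
    (fun x hx => (hf x hx).1.differentiableWithinAt) fun x hx => ?_
  ext v
  have : v = ∑ μ, v μ • (Pi.single μ (1 : ℝ) : Spacetime) := by
    ext i; simp [Finset.sum_apply, Pi.single_apply]
  rw [this, map_sum]
  refine Finset.sum_eq_zero fun μ _ => ?_
  have h := (hf x hx).2 μ
  rw [pd] at h
  rw [map_smul, h, smul_zero]

end Calculus

/-! ### From conformal Killing fields to shear-free congruences. -/

section

lemma eta_apply (μ ν : Fin 4) : eta μ ν = if μ = ν then (if μ = 0 then -1 else 1) else 0 := by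
  fin_cases μ <;> fin_cases ν <;> simp [eta]

lemma eta_self_mul_self (μ : Fin 4) : eta μ μ * eta μ μ = 1 := by
  rw [eta_apply, if_pos rfl]; split_ifs <;> simp

lemma metric_eq (v w : Fin 4 → ℝ) : metric v w = ∑ μ, eta μ μ * v μ * w μ := by
  simp [metric, eta_apply, Fin.sum_univ_four]

lemma lieMetric_eq (ξ : Spacetime → Fin 4 → ℝ) (x : Spacetime) (μ ν : Fin 4) :
    lieMetric ξ x μ ν =
      eta ν ν * pd μ (fun y => ξ y ν) x + eta μ μ * pd ν (fun y => ξ y μ) x := by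
  rw [lieMetric, Finset.sum_add_distrib]
  congr 1
  · exact Finset.sum_eq_single ν (fun b _ hb => by simp [eta_apply, hb]) (by simp)
  · exact Finset.sum_eq_single μ (fun b _ hb => by simp [eta_apply, hb.symm]) (by simp)

/-- The covariant components of a vector field. -/
def lower (u : Spacetime → Fin 4 → ℝ) (ν : Fin 4) (x : Spacetime) : ℝ := eta ν ν * u x ν

lemma eta_mul_lower (u : Spacetime → Fin 4 → ℝ) (ν : Fin 4) (x : Spacetime) :
    eta ν ν * lower u ν x = u x ν := by
  rw [lower, ← mul_assoc, eta_self_mul_self, one_mul]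

/-- A unit congruence `v` (covariant components) without shear, whose acceleration is
`∂_ν ψ + H v_ν` and whose expansion is `3 H`. -/
structure IsShearFree (v : Fin 4 → Spacetime → ℝ) (ψ H : Spacetime → ℝ) (U : Set Spacetime) :
    Prop where
  smooth_v : ∀ ν, ContDiffOn ℝ ∞ (v ν) U
  smooth_psi : ContDiffOn ℝ ∞ ψ U
  smooth_H : ContDiffOn ℝ ∞ H U
  unit : ∀ x ∈ U, ∑ μ, eta μ μ * v μ x * v μ x = -1
  symm_pd : ∀ x ∈ U, ∀ μ ν, pd μ (v ν) x + pd ν (v μ) x =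
    2 * H x * eta μ ν - pd μ ψ x * v ν x - pd ν ψ x * v μ x
  rate : ∀ x ∈ U, ∑ μ, eta μ μ * v μ x * pd μ ψ x = H x

variable {u : Spacetime → Fin 4 → ℝ} {v : Fin 4 → Spacetime → ℝ} {ψ H : Spacetime → ℝ}
  {U : Set Spacetime}

lemma sum_mul_pd_eq_zero (hU : IsOpen U) (hv : ∀ ν, ContDiffOn ℝ ∞ (v ν) U)
    (h1 : ∀ x ∈ U, ∑ μ, eta μ μ * v μ x * v μ x = -1) {x : Spacetime} (hx : x ∈ U) (μ : Fin 4) :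
    ∑ ν, eta ν ν * v ν x * pd μ (v ν) x = 0 := by
  have hd : ∀ ν, HasPd (v ν) (fun μ => pd μ (v ν) x) x := fun ν =>
    hasPd_of_contDiffOn (hv ν) hU hx
  have h := HasPd.sum (x := x) Finset.univ fun ν _ => ((hd ν).const_mul (eta ν ν)).mul (hd ν)
  have h2 := (h.2 μ).symm.trans ((pd_congr hU hx h1 μ).trans ((hasPd_const (-1)).2 μ))
  have h3 : ∑ ν, (eta ν ν * pd μ (v ν) x * v ν x + eta ν ν * v ν x * pd μ (v ν) x) =
      2 * ∑ ν, eta ν ν * v ν x * pd μ (v ν) x := by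
    rw [Finset.mul_sum]; exact Finset.sum_congr rfl fun _ _ => by ring
  have h4 := h3.symm.trans h2
  simpa using h4

lemma contDiffOn_lower (hu : ContDiffOn ℝ ∞ u U) (ν : Fin 4) : ContDiffOn ℝ ∞ (lower u ν) U :=
  contDiffOn_const.mul (contDiffOn_pi.1 hu ν)

lemma IsUnitVelocity.lower_unit (hu : IsUnitVelocity u U) :
    ∀ x ∈ U, ∑ μ, eta μ μ * lower u μ x * lower u μ x = -1 := by
  intro x hx
  rw [← (hu.2 x hx).1, metric_eq]
  refine Finset.sum_congr rfl fun μ _ => ?_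
  rw [eta_mul_lower, lower]; ring

lemma divergence_eq (hU : IsOpen U) (hu : ContDiffOn ℝ ∞ u U) {x : Spacetime} (hx : x ∈ U) :
    divergence u x = ∑ μ, eta μ μ * pd μ (lower u μ) x := by
  refine Finset.sum_congr rfl fun μ _ => ?_
  have h := ((hasPd_of_contDiffOn (contDiffOn_lower hu μ) hU hx).const_mul (eta μ μ)).2 μ
  simpa only [eta_mul_lower] using h

lemma contDiffOn_expansion (hU : IsOpen U) (hu : ContDiffOn ℝ ∞ u U) :
    ContDiffOn ℝ ∞ (expansion u) U := by
  change ContDiffOn ℝ ∞ (fun x => ∑ μ, pd μ (fun y => u y μ) x) U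
  exact ContDiffOn.sum fun μ _ => contDiffOn_pd (contDiffOn_pi.1 hu μ) hU μ

/-- Take ψ = log |ξ|. Substituting ξ = |ξ| u into L_ξ g = 2 l g and dividing by |ξ| gives the
symmetric derivative of u with coefficient l/|ξ|; contractions with u and with the metric identify
this coefficient as both u(ψ) and θ/3. -/
lemma IsConformallyStationary.isShearFree (hU : IsOpen U) (hu : IsUnitVelocity u U)
    (h : IsConformallyStationary u U) :
    ∃ ψ, IsShearFree (lower u) ψ (fun x => expansion u x / 3) U := by
  obtain ⟨ξ, ⟨hξ, l, hl⟩, hξu⟩ := h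
  have hξ' := contDiffOn_pi.1 hξ
  have hpos : ∀ x ∈ U, 0 < modulus (ξ x) := fun x hx =>
    Real.sqrt_pos.2 (by linarith [(hξu x hx).1])
  have hσ : ContDiffOn ℝ ∞ (fun x => modulus (ξ x)) U := by
    refine ContDiffOn.sqrt ?_ fun x hx => by linarith [(hξu x hx).1]
    refine ContDiffOn.neg ?_
    simp only [metric_eq]
    exact ContDiffOn.sum fun μ _ => (contDiffOn_const.mul (hξ' μ)).mul (hξ' μ)
  have hψ : ContDiffOn ℝ ∞ (fun x => Real.log (modulus (ξ x))) U :=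
    hσ.log fun x hx => (hpos x hx).ne'
  have hv := contDiffOn_lower hu.1
  have hmain : ∀ x ∈ U, ∀ μ ν, pd μ (lower u ν) x + pd ν (lower u μ) x =
      2 * (l x / modulus (ξ x)) * eta μ ν
        - pd μ (fun x => Real.log (modulus (ξ x))) x * lower u ν x
        - pd ν (fun x => Real.log (modulus (ξ x))) x * lower u μ x := by
    intro x hx μ ν
    have hs := hasPd_of_contDiffOn hσ hU hx
    have key : ∀ μ ν, eta ν ν * pd μ (fun y => ξ y ν) x =
        pd μ (fun y => modulus (ξ y)) x * lower u ν x + modulus (ξ x) * pd μ (lower u ν) x := by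
      intro μ ν
      have h1 := hs.mul (hasPd_of_contDiffOn (hv ν) hU hx)
      refine (((hasPd_of_contDiffOn (hξ' ν) hU hx).const_mul (eta ν ν)).2 μ).symm.trans
        ((pd_congr hU hx (fun y hy => ?_) μ).trans (h1.2 μ))
      rw [lower, (hξu y hy).2, Pi.smul_apply, smul_eq_mul]
      field_simp [(hpos y hy).ne']
    have h2 := hl x hx μ ν
    rw [lieMetric_eq, key, key] at h2
    have h0 := (hpos x hx).ne'
    rw [(hs.log h0).2, (hs.log h0).2]
    field_simp
    linarith
  have hcontr : ∀ x ∈ U, ∑ μ, eta μ μ * lower u μ x *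
      pd μ (fun x => Real.log (modulus (ξ x))) x = l x / modulus (ξ x) ∧
      expansion u x = 3 * (l x / modulus (ξ x)) := by
    intro x hx
    have h1 := hu.lower_unit x hx
    have h2 := sum_mul_pd_eq_zero hU hv hu.lower_unit hx
    have h3 := hmain x hx
    rw [expansion, divergence_eq hU hu.1 hx]
    set d := fun μ ν => pd μ (lower u ν) x with hd
    set p := fun μ => pd μ (fun x => Real.log (modulus (ξ x))) x with hp
    set V := fun μ => lower u μ x with hV
    set m := l x / modulus (ξ x) with hm
    change ∑ μ, eta μ μ * V μ * V μ = -1 at h1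
    change ∀ μ, ∑ ν, eta ν ν * V ν * d μ ν = 0 at h2
    change ∀ μ ν, d μ ν + d ν μ = 2 * m * eta μ ν - p μ * V ν - p ν * V μ at h3
    change ∑ μ, eta μ μ * V μ * p μ = m ∧ ∑ μ, eta μ μ * d μ μ = 3 * m
    clear_value d p V m
    -- Contracting `h3` twice with u kills the left side, because u has constant length; what
    -- remains is u(ψ) = m.
    have hA : ∑ μ, eta μ μ * V μ * p μ = m := by
      have e : ∑ μ, ∑ ν, eta μ μ * V μ * (eta ν ν * V ν) * (d μ ν + d ν μ) = 0 := by
        have e1 : ∑ μ, ∑ ν, eta μ μ * V μ * (eta ν ν * V ν) * d μ ν = 0 := by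
          refine Finset.sum_eq_zero fun μ _ => ?_
          simp only [mul_assoc, ← Finset.mul_sum]
          simp only [← mul_assoc, h2, mul_zero]
        have e2 : ∑ μ, ∑ ν, eta μ μ * V μ * (eta ν ν * V ν) * d ν μ = 0 := by
          rw [Finset.sum_comm, ← e1]
          exact Finset.sum_congr rfl fun _ _ => Finset.sum_congr rfl fun _ _ => by ring
        simp only [mul_add, Finset.sum_add_distrib, e1, e2, add_zero]
      simp only [h3] at e
      simp only [Fin.sum_univ_four, eta_apply] at e h1 ⊢
      simp at e h1 ⊢
      grind
    refine ⟨hA, ?_⟩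
    -- Trace of `h3`: 8m from the metric term, less 2u(ψ) = 2m.
    have e : ∑ μ, eta μ μ * (d μ μ + d μ μ) = 6 * m := by
      simp only [h3]
      simp only [Fin.sum_univ_four, eta_apply] at hA ⊢
      simp at hA ⊢
      linear_combination (-2) * hA
    simp only [Fin.sum_univ_four] at e ⊢
    linear_combination e / 2
  refine ⟨_, hv, hψ, (contDiffOn_expansion hU hu.1).div_const 3, hu.lower_unit, ?_, ?_⟩
  · intro x hx μ ν
    rw [hmain x hx, (hcontr x hx).2]; ring
  · intro x hx
    rw [(hcontr x hx).1, (hcontr x hx).2]; ring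

end

/-! ### Absence of rotation. -/

section

variable {u : Spacetime → Fin 4 → ℝ} {v : Fin 4 → Spacetime → ℝ} {ψ H : Spacetime → ℝ}
  {U : Set Spacetime}

lemma IsShearFree.mono (h : IsShearFree v ψ H U) {W : Set Spacetime} (hW : W ⊆ U) :
    IsShearFree v ψ H W :=
  ⟨fun ν => (h.smooth_v ν).mono hW, h.smooth_psi.mono hW, h.smooth_H.mono hW,
    fun x hx => h.unit x (hW hx), fun x hx => h.symm_pd x (hW hx), fun x hx => h.rate x (hW hx)⟩

/-- Linear algebra behind the absence of rotation of a radial shear-free congruence. -/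
lemma skew_eq_zero_of_radial {A : Fin 4 → Fin 4 → ℝ} {V x : Fin 4 → ℝ} {c : ℝ}
    (hskew : ∀ μ ν, A μ ν = -A ν μ) (hV : ∀ μ, ∑ ν, eta ν ν * V ν * A μ ν = 0)
    (hx : x 1 ^ 2 + x 2 ^ 2 + x 3 ^ 2 ≠ 0) (h0 : V 0 ≠ 0)
    (hr : ∀ k i j : Fin 4, k ≠ 0 → i ≠ 0 → j ≠ 0 →
      (A k i - c * eta k i) * x j = (A k j - c * eta k j) * x i) (μ ν : Fin 4) : A μ ν = 0 := by
  have hd : ∀ μ, A μ μ = 0 := fun μ => by linarith [hskew μ μ]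
  -- By `hr` each row of the spatial block of A - c·1 is parallel to x, so this block has the form w
  -- ⊗ x. Its symmetric part is -c·1, of rank at most two in dimension three; hence c = 0.
  have hc : c = 0 := by
    have h112 := hr 1 1 2 (by decide) (by decide) (by decide)
    have h113 := hr 1 1 3 (by decide) (by decide) (by decide)
    have h221 := hr 2 2 1 (by decide) (by decide) (by decide)
    have h223 := hr 2 2 3 (by decide) (by decide) (by decide)
    have h331 := hr 3 3 1 (by decide) (by decide) (by decide)
    have h332 := hr 3 3 2 (by decide) (by decide) (by decide)
    simp [eta_apply, hd] at h112 h113 h221 h223 h331 h332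
    rw [hskew 2 1] at h221
    rw [hskew 3 1] at h331
    rw [hskew 3 2] at h332
    have : c * (x 1 ^ 2 + x 2 ^ 2 + x 3 ^ 2) = 0 := by
      linear_combination (-x 2 / 2) * h112 - x 3 / 2 * h113 - x 1 / 2 * h221 - x 3 / 2 * h223
        - x 1 / 2 * h331 - x 2 / 2 * h332
    exact (mul_eq_zero.1 this).resolve_right hx
  subst hc
  -- Now the spatial block of A is skew and equal to w ⊗ x, which forces it to vanish.
  have hspat : ∀ i j k : Fin 4, i ≠ 0 → j ≠ 0 → k ≠ 0 → A i j * x k = A i k * x j := by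
    intro i j k hi hj hk
    simpa using hr i j k hi hj hk
  have h12 : A 1 2 = 0 := by
    have a := hspat 1 2 1 (by decide) (by decide) (by decide)
    have b := hspat 2 1 2 (by decide) (by decide) (by decide)
    have c := hspat 1 2 3 (by decide) (by decide) (by decide)
    have d := hspat 2 1 3 (by decide) (by decide) (by decide)
    have f := hspat 3 1 2 (by decide) (by decide) (by decide)
    rw [hskew 2 1] at b d
    rw [hskew 3 1, hskew 3 2] at f
    rw [hd] at a b
    refine (mul_eq_zero.1 (?_ : A 1 2 * (x 1 ^ 2 + x 2 ^ 2 + x 3 ^ 2) = 0)).resolve_right hx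
    linear_combination x 1 * a - x 2 * b + x 3 / 2 * (c - d - f)
  have h13 : A 1 3 = 0 := by
    have a := hspat 1 3 1 (by decide) (by decide) (by decide)
    have b := hspat 3 1 3 (by decide) (by decide) (by decide)
    have c := hspat 1 3 2 (by decide) (by decide) (by decide)
    rw [hskew 3 1] at b
    rw [hd] at a b
    rw [h12] at c
    refine (mul_eq_zero.1 (?_ : A 1 3 * (x 1 ^ 2 + x 2 ^ 2 + x 3 ^ 2) = 0)).resolve_right hx
    linear_combination x 1 * a - x 3 * b + x 2 * c
  have h23 : A 2 3 = 0 := by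
    have a := hspat 2 3 2 (by decide) (by decide) (by decide)
    have b := hspat 3 2 3 (by decide) (by decide) (by decide)
    have c := hspat 2 3 1 (by decide) (by decide) (by decide)
    rw [hskew 3 2] at b
    rw [hd] at a b
    rw [hskew 2 1, h12] at c
    refine (mul_eq_zero.1 (?_ : A 2 3 * (x 1 ^ 2 + x 2 ^ 2 + x 3 ^ 2) = 0)).resolve_right hx
    linear_combination x 2 * a - x 3 * b + x 1 * c
  have h21 : A 2 1 = 0 := by rw [hskew, h12, neg_zero]
  have h31 : A 3 1 = 0 := by rw [hskew, h13, neg_zero]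
  have h32 : A 3 2 = 0 := by rw [hskew, h23, neg_zero]
  -- With no spatial block left, A V = 0 reduces to A i 0 · V 0 = 0.
  have ht : ∀ i : Fin 4, i ≠ 0 → A i 0 = 0 := by
    intro i hi
    have h := hV i
    simp only [Fin.sum_univ_four, eta_apply] at h
    have : A i 1 = 0 ∧ A i 2 = 0 ∧ A i 3 = 0 := by
      fin_cases i
      · exact absurd rfl hi
      · exact ⟨hd 1, h12, h13⟩
      · exact ⟨h21, hd 2, h23⟩
      · exact ⟨h31, h32, hd 3⟩
    simpa [this.1, this.2.1, this.2.2, h0] using h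
  have ht' : ∀ i : Fin 4, i ≠ 0 → A 0 i = 0 := fun i hi => by rw [hskew, ht i hi, neg_zero]
  fin_cases μ <;> fin_cases ν <;>
    first
      | exact hd _
      | exact ht _ (by decide)
      | exact ht' _ (by decide)
      | assumption

/-- The difference of the two sides is skew and annihilates the velocity; differentiating v_i x_j =
v_j x_i supplies the row condition of `skew_eq_zero_of_radial`. -/
lemma IsShearFree.pd_eq_of_radial (h : IsShearFree v ψ H U) (hU : IsOpen U)
    (hrad : ∀ x ∈ U, ∃ b : ℝ, ∀ i : Fin 4, i ≠ 0 → v i x = b * x i) {x : Spacetime} (hx : x ∈ U)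
    (h0 : v 0 x ≠ 0) (hr : x 1 ^ 2 + x 2 ^ 2 + x 3 ^ 2 ≠ 0) (μ ν : Fin 4) :
    pd μ (v ν) x = H x * eta μ ν - v μ x * pd ν ψ x := by
  have hu := h.unit x hx
  have hs := h.symm_pd x hx
  have hrate := h.rate x hx
  have hz := sum_mul_pd_eq_zero hU h.smooth_v h.unit hx
  obtain ⟨b, hb⟩ := hrad x hx
  have hR : ∀ μ i j : Fin 4, i ≠ 0 → j ≠ 0 →
      pd μ (v i) x * x j + v i x * (if μ = j then 1 else 0) =
      pd μ (v j) x * x i + v j x * (if μ = i then 1 else 0) := by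
    intro μ i j hi hj
    have h1 := (hasPd_of_contDiffOn (h.smooth_v i) hU hx).mul (hasPd_coord j)
    have h2 := (hasPd_of_contDiffOn (h.smooth_v j) hU hx).mul (hasPd_coord i)
    refine (h1.2 μ).symm.trans ((pd_congr hU hx (fun y hy => ?_) μ).trans (h2.2 μ))
    obtain ⟨b, hb⟩ := hrad y hy
    rw [hb i hi, hb j hj]; ring
  set d := fun μ ν => pd μ (v ν) x with hd
  set p := fun μ => pd μ ψ x with hp
  set V := fun μ => v μ x with hV
  set m := H x with hm
  change ∑ μ, eta μ μ * V μ * V μ = -1 at hu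
  change ∀ μ ν, d μ ν + d ν μ = 2 * m * eta μ ν - p μ * V ν - p ν * V μ at hs
  change ∑ μ, eta μ μ * V μ * p μ = m at hrate
  change ∀ μ, ∑ ν, eta ν ν * V ν * d μ ν = 0 at hz
  change ∀ i : Fin 4, i ≠ 0 → V i = b * x i at hb
  change ∀ μ i j : Fin 4, i ≠ 0 → j ≠ 0 → d μ i * x j + V i * (if μ = j then 1 else 0) =
      d μ j * x i + V j * (if μ = i then 1 else 0) at hR
  change V 0 ≠ 0 at h0
  change d μ ν = m * eta μ ν - V μ * p ν
  clear_value d p V m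
  clear hrad
  have hVd : ∀ i, ∑ μ, eta μ μ * V μ * d μ i = m * V i + p i := by
    intro i
    have e : ∑ μ, eta μ μ * V μ * (d μ i + d i μ) = m * V i + p i := by
      simp only [hs]
      simp only [Fin.sum_univ_four, eta_apply] at hu hrate ⊢
      fin_cases i <;> simp at hu hrate ⊢
      · linear_combination (-p 0) * hu - V 0 * hrate
      · linear_combination (-p 1) * hu - V 1 * hrate
      · linear_combination (-p 2) * hu - V 2 * hrate
      · linear_combination (-p 3) * hu - V 3 * hrate
    simpa only [mul_add, Finset.sum_add_distrib, hz, add_zero] using e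
  -- Contracting `hR` with the velocity shows that the spatial gradient of ψ is radial too.
  have hpr : ∀ i j : Fin 4, i ≠ 0 → j ≠ 0 → p i * x j = p j * x i := by
    intro i j hi hj
    have e : ∑ μ, eta μ μ * V μ * (d μ i * x j + V i * (if μ = j then 1 else 0)) =
        ∑ μ, eta μ μ * V μ * (d μ j * x i + V j * (if μ = i then 1 else 0)) :=
      Finset.sum_congr rfl fun μ _ => by rw [hR μ i j hi hj]
    simp only [mul_add, Finset.sum_add_distrib, ← mul_assoc, ← Finset.sum_mul, hVd] at e
    simp [eta_apply, hi, hj] at e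
    rw [hb i hi, hb j hj] at e
    linear_combination e
  have hfin := skew_eq_zero_of_radial (A := fun μ ν => d μ ν - (m * eta μ ν - V μ * p ν))
    (V := V) (x := x) (c := b - m) ?_ ?_ hr h0 ?_ μ ν
  · simpa [sub_eq_zero] using hfin
  · intro μ ν
    have hsym : eta μ ν = eta ν μ := by simp only [eta_apply]; grind
    simp only [← hsym]
    linear_combination hs μ ν
  · intro μ
    have h1 := hz μ
    simp only [Fin.sum_univ_four, eta_apply] at hu hrate h1 ⊢
    fin_cases μ <;> simp at hu hrate h1 ⊢
    · linear_combination h1 + V 0 * hrate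
    · linear_combination h1 + V 1 * hrate
    · linear_combination h1 + V 2 * hrate
    · linear_combination h1 + V 3 * hrate
  · intro k i j hk hi hj
    have e1 := hR k i j hi hj
    have e2 := hpr i j hi hj
    have e3 : ∀ l, eta k l = if k = l then 1 else 0 := fun l => by simp [eta_apply, hk]
    simp only [← e3] at e1
    rw [hb i hi, hb j hj] at e1
    linear_combination e1 + V k * e2

end

/-! ### Consequences of flatness, and the equations of motion of the gas. -/

section

variable {u : Spacetime → Fin 4 → ℝ} {v : Fin 4 → Spacetime → ℝ} {ψ H : Spacetime → ℝ}
  {U : Set Spacetime}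

/-- The expansion of an irrotational shear-free congruence in flat space-time is constant
orthogonally to the flow. -/
lemma IsShearFree.exists_pd_H (h : IsShearFree v ψ H U) (hU : IsOpen U)
    (hD : ∀ x ∈ U, ∀ μ ν, pd μ (v ν) x = H x * eta μ ν - v μ x * pd ν ψ x) {x : Spacetime}
    (hx : x ∈ U) :
    ∀ α, 2 * pd α H x = -(∑ μ, eta μ μ * pd μ (pd μ ψ) x) * v α x := by
  have hv := fun ν => hasPd_of_contDiffOn (h.smooth_v ν) hU hx
  have hH := hasPd_of_contDiffOn h.smooth_H hU hx
  have hψ := fun ν => hasPd_of_contDiffOn (contDiffOn_pd h.smooth_psi hU ν) hU hx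
  -- Integrability condition ∂_α ∂_μ v_ν = ∂_μ ∂_α v_ν; this is where flatness enters.
  have hX : ∀ α μ ν, pd α H x * eta μ ν - (pd α (v μ) x * pd ν ψ x + v μ x * pd α (pd ν ψ) x) =
      pd μ H x * eta α ν - (pd μ (v α) x * pd ν ψ x + v α x * pd μ (pd ν ψ) x) := by
    have e : ∀ α μ ν, pd α (pd μ (v ν)) x =
        pd α H x * eta μ ν - (pd α (v μ) x * pd ν ψ x + v μ x * pd α (pd ν ψ) x) := by
      intro α μ ν
      have h1 := ((hH.mul (hasPd_const (eta μ ν))).sub ((hv μ).mul (hψ ν))).2 α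
      simp only [mul_zero, add_zero] at h1
      rw [pd_congr hU hx (fun y hy => hD y hy μ ν) α, h1]
    intro α μ ν
    rw [← e, ← e, pd_comm (h.smooth_v ν) hU hx]
  have hY : ∀ α, pd α H x =
      ∑ ν, eta ν ν * (pd α (v ν) x * pd ν ψ x + v ν x * pd α (pd ν ψ) x) := by
    intro α
    have h1 := (HasPd.sum (x := x) Finset.univ fun ν _ =>
      ((hv ν).const_mul (eta ν ν)).mul (hψ ν)).2 α
    rw [← pd_congr hU hx (fun y hy => h.rate y hy) α, h1]
    exact Finset.sum_congr rfl fun _ _ => by ring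
  have hr := h.rate x hx
  have hDx := hD x hx
  intro α
  set d := fun μ ν => pd μ (v ν) x with hd
  set p := fun μ => pd μ ψ x with hp
  set q := fun μ ν => pd μ (pd ν ψ) x with hq
  set G := fun μ => pd μ H x with hG
  set V := fun μ => v μ x with hV
  set m := H x with hm
  change ∀ α μ ν, G α * eta μ ν - (d α μ * p ν + V μ * q α ν) =
      G μ * eta α ν - (d μ α * p ν + V α * q μ ν) at hX
  change ∀ α, G α = ∑ ν, eta ν ν * (d α ν * p ν + V ν * q α ν) at hY
  change ∑ μ, eta μ μ * V μ * p μ = m at hr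
  change ∀ μ ν, d μ ν = m * eta μ ν - V μ * p ν at hDx
  change 2 * G α = -(∑ μ, eta μ μ * q μ μ) * V α
  clear_value d p q G V m
  -- Trace over μ = ν. By `hY`, the derivative of H = u(ψ), the left side is 4G - G; the right side
  -- is G - (□ψ) V.
  have h1 : ∑ μ, eta μ μ * (G α * eta μ μ - (d α μ * p μ + V μ * q α μ)) =
      ∑ μ, eta μ μ * (G μ * eta α μ - (d μ α * p μ + V α * q μ μ)) :=
    Finset.sum_congr rfl fun μ _ => by rw [hX]
  have h2 : ∑ μ, eta μ μ * (d μ α * p μ) = 0 := by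
    have : ∑ μ, eta μ μ * (d μ α * p μ) =
        m * (∑ μ, eta μ μ * eta μ α * p μ) - p α * ∑ μ, eta μ μ * V μ * p μ := by
      rw [Finset.mul_sum, Finset.mul_sum, ← Finset.sum_sub_distrib]
      exact Finset.sum_congr rfl fun μ _ => by rw [hDx]; ring
    rw [this, hr, Finset.sum_eq_single α (fun b _ hb => by simp [eta_apply b α, hb]) (by simp),
      eta_self_mul_self]
    ring
  have h3 : ∑ μ, eta μ μ * (G μ * eta α μ) = G α := by
    rw [Finset.sum_eq_single α (fun b _ hb => by simp [eta_apply α b, hb.symm]) (by simp)]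
    linear_combination G α * eta_self_mul_self α
  have h4 : ∑ μ, eta μ μ * (G α * eta μ μ) = 4 * G α := by
    rw [Finset.sum_congr rfl fun μ _ =>
      (show eta μ μ * (G α * eta μ μ) = G α by linear_combination G α * eta_self_mul_self μ)]
    simp
  have h5 : ∑ μ, eta μ μ * (V α * q μ μ) = (∑ μ, eta μ μ * q μ μ) * V α := by
    rw [Finset.sum_mul]; exact Finset.sum_congr rfl fun _ _ => by ring
  simp only [mul_sub, Finset.sum_sub_distrib, h4, h3, ← hY] at h1
  simp only [mul_add, Finset.sum_add_distrib, h2, h5] at h1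
  linear_combination h1

variable {k cv : ℝ} {ρ p n ε s Θ : Spacetime → ℝ}

lemma IsClassicalIdealGas.temp_ne_zero (h : IsClassicalIdealGas k cv u ρ p n ε s Θ U)
    {x : Spacetime} (hx : x ∈ U) : Θ x ≠ 0 := by
  have := h.p_pos x hx
  rw [h.state_p x hx] at this
  exact right_ne_zero_of_mul this.ne'

lemma IsClassicalIdealGas.density_ne_zero (h : IsClassicalIdealGas k cv u ρ p n ε s Θ U)
    {x : Spacetime} (hx : x ∈ U) : n x ≠ 0 := by
  have := h.p_pos x hx
  rw [h.state_p x hx] at this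
  exact right_ne_zero_of_mul (left_ne_zero_of_mul this.ne')

/-- The hydrodynamic equations of a classical ideal gas, solved for the derivative of the
temperature along the flow and for the gradient of the pressure. -/
lemma IsClassicalIdealGas.pd_eqs (h : IsClassicalIdealGas k cv u ρ p n ε s Θ U) (hU : IsOpen U)
    {x : Spacetime} (hx : x ∈ U) :
    cv * ∑ μ, u x μ * pd μ Θ x = -k * Θ x * expansion u x ∧
    ∀ ν, pd ν p x = -(n x * (1 + (cv + k) * Θ x)) * (∑ μ, u x μ * pd μ (lower u ν) x)
      + (1 + k / cv) * expansion u x * p x * lower u ν x := by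
  have hv := contDiffOn_lower h.unit_velocity.1
  have hv' := fun ν => hasPd_of_contDiffOn (hv ν) hU hx
  have hn := hasPd_of_contDiffOn h.smooth_n hU hx
  have hT := hasPd_of_contDiffOn h.smooth_temp hU hx
  have hu' := fun ν => hasPd_of_contDiffOn (contDiffOn_pi.1 h.unit_velocity.1 ν) hU hx
  have hm := h.matter x hx
  have hunit := h.unit_velocity.lower_unit x hx
  have hort := sum_mul_pd_eq_zero hU hv h.unit_velocity.lower_unit hx
  have hm1 : (∑ μ, u x μ * pd μ n x) + n x * expansion u x = 0 := by
    rw [← hm, expansion, divergence, divergence, Finset.mul_sum, ← Finset.sum_add_distrib]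
    refine Finset.sum_congr rfl fun μ _ => ?_
    have := (hn.mul (hu' μ)).2 μ
    simp only [Pi.smul_apply, smul_eq_mul]
    rw [this]; ring
  have hp : HasPd p (fun μ => k * (pd μ n x * Θ x + n x * pd μ Θ x)) x :=
    HasPd.congr hU hx (fun y hy => by rw [h.state_p y hy, mul_assoc]) ((hn.mul hT).const_mul k)
  have hρp : HasPd (fun y => ρ y + p y) (fun μ => pd μ n x * (1 + (cv + k) * Θ x) +
      n x * ((cv + k) * pd μ Θ x)) x := by
    have := hn.mul ((hasPd_const (x := x) 1).add (hT.const_mul (cv + k)))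
    simp only [zero_add] at this
    refine this.congr hU hx fun y hy => ?_
    rw [h.decomposition y hy, h.state_p y hy, h.state_eps y hy]; ring
  -- Conservation of T with the free index lowered, where ρ + p = n(1 + (c_v + k)Θ).
  have hc : ∀ ν, (∑ μ, u x μ * (pd μ n x * (1 + (cv + k) * Θ x) +
      n x * ((cv + k) * pd μ Θ x))) * lower u ν x + (n x * (1 + (cv + k) * Θ x)) *
      (expansion u x * lower u ν x + ∑ μ, u x μ * pd μ (lower u ν) x) + pd ν p x = 0 := by
    intro ν
    have h1 := h.conservation x hx ν
    have h2 : ∀ μ, pd μ (fun y => energyTensor u ρ p y μ ν) x =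
        eta ν ν * (((pd μ n x * (1 + (cv + k) * Θ x) +
      n x * ((cv + k) * pd μ Θ x)) * u x μ + (ρ x + p x) * pd μ (fun y => u y μ) x)
         * lower u ν x + (ρ x + p x) * u x μ * pd μ (lower u ν) x) + pd μ p x * eta μ ν := by
      intro μ
      have h3 := (((((hρp.mul (hu' μ))).mul (hv' ν)).const_mul (eta ν ν)).add
        (hp.1.hasPd.mul (hasPd_const (eta μ ν)))).2 μ
      simp only [mul_zero, add_zero] at h3
      rw [← h3]
      refine pd_congr hU hx (fun y _ => ?_) μ
      rw [energyTensor, ← eta_mul_lower u ν y]; ring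
    simp only [h2] at h1
    have h4 : ∑ μ, pd μ p x * eta μ ν = eta ν ν * pd ν p x := by
      rw [Finset.sum_eq_single ν (fun b _ hb => by simp [eta_apply b ν, hb]) (by simp), mul_comm]
    rw [Finset.sum_add_distrib, h4, ← Finset.mul_sum, ← mul_add] at h1
    have h5 : eta ν ν ≠ 0 := left_ne_zero_of_mul_eq_one (eta_self_mul_self ν)
    have h6 := (mul_eq_zero.1 h1).resolve_left h5
    have h7 : ρ x + p x = n x * (1 + (cv + k) * Θ x) := by
      rw [h.decomposition x hx, h.state_p x hx, h.state_eps x hx]; ring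
    rw [h7] at h6
    rw [← h6, expansion, divergence]
    simp only [Finset.sum_mul, Finset.mul_sum, mul_add, add_mul, Finset.sum_add_distrib]
    simp only [Fin.sum_univ_four]
    ring
  have hpu : ∑ ν, u x ν * pd ν p x = k * ((∑ μ, u x μ * pd μ n x) * Θ x +
      n x * ∑ μ, u x μ * pd μ Θ x) := by
    simp only [hp.2, Finset.sum_mul, Finset.mul_sum, mul_add, Finset.sum_add_distrib]
    congr 1 <;> exact Finset.sum_congr rfl fun _ _ => by ring
  have hsum : (∑ μ, u x μ * (pd μ n x * (1 + (cv + k) * Θ x) +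
      n x * ((cv + k) * pd μ Θ x))) = (∑ μ, u x μ * pd μ n x) * (1 + (cv + k) * Θ x) +
      n x * (cv + k) * ∑ μ, u x μ * pd μ Θ x := by
    simp only [Finset.sum_mul, Finset.mul_sum, mul_add, Finset.sum_add_distrib]
    simp only [Fin.sum_univ_four]
    ring
  simp only [hsum] at hc
  have hul : ∑ ν, u x ν * lower u ν x = -1 := by
    rw [← hunit]; exact Finset.sum_congr rfl fun ν _ => by rw [← eta_mul_lower u ν x]
  have hua : ∑ ν, u x ν * ∑ μ, u x μ * pd μ (lower u ν) x = 0 := by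
    simp only [Finset.mul_sum]
    rw [Finset.sum_comm]
    refine Finset.sum_eq_zero fun μ _ => ?_
    rw [← mul_zero (u x μ), ← hort μ, Finset.mul_sum]
    refine Finset.sum_congr rfl fun ν _ => ?_
    rw [eta_mul_lower]; ring
  set A := ∑ μ, u x μ * pd μ n x
  set B := ∑ μ, u x μ * pd μ Θ x
  set θ := expansion u x
  -- Component of `hc` along u; the acceleration drops out, being orthogonal to u.
  have henergy : -(A * (1 + (cv + k) * Θ x) + n x * (cv + k) * B)
      - n x * (1 + (cv + k) * Θ x) * θ + k * (A * Θ x + n x * B) = 0 := by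
    rw [← hpu]
    have : ∑ ν, u x ν * ((A * (1 + (cv + k) * Θ x) + n x * (cv + k) * B) * lower u ν x +
      (n x * (1 + (cv + k) * Θ x)) * (θ * lower u ν x + ∑ μ, u x μ * pd μ (lower u ν) x)
        + pd ν p x) = 0 := Finset.sum_eq_zero fun ν _ => by rw [hc, mul_zero]
    rw [← this]
    have e : ∀ ν, u x ν * ((A * (1 + (cv + k) * Θ x) + n x * (cv + k) * B) * lower u ν x +
      (n x * (1 + (cv + k) * Θ x)) * (θ * lower u ν x + ∑ μ, u x μ * pd μ (lower u ν) x)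
        + pd ν p x) = (A * (1 + (cv + k) * Θ x) + n x * (cv + k) * B +
          n x * (1 + (cv + k) * Θ x) * θ) * (u x ν * lower u ν x) +
          (n x * (1 + (cv + k) * Θ x)) * (u x ν * ∑ μ, u x μ * pd μ (lower u ν) x) +
          u x ν * pd ν p x := fun ν => by ring
    rw [Finset.sum_congr rfl fun ν _ => e ν, Finset.sum_add_distrib, Finset.sum_add_distrib,
      ← Finset.mul_sum, ← Finset.mul_sum, hul, hua]
    ring
  have hn0 := h.density_ne_zero hx
  have hcv := h.cv_pos.ne'
  have hB : cv * B = -k * Θ x * θ := by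
    apply mul_left_cancel₀ hn0
    linear_combination (-1 : ℝ) * henergy - (1 + cv * Θ x) * hm1
  refine ⟨hB, fun ν => ?_⟩
  have hB' : B = -k * Θ x * θ / cv := by rw [← hB]; field_simp
  have hA' : A = -(n x * θ) := by linarith
  have h1 := hc ν
  rw [hA', hB'] at h1
  rw [h.state_p x hx]
  field_simp
  field_simp at h1
  linear_combination h1

end

/-! ### Geodesic motion, the Riccati equation and the common event. -/

section

variable {u : Spacetime → Fin 4 → ℝ} {ψ : Spacetime → ℝ} {U : Set Spacetime}
  {k cv : ℝ} {ρ p n ε s Θ : Spacetime → ℝ}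

/-- An irrotational shear-free congruence of non-zero expansion which is the flow of a classical
ideal gas is geodesic. -/
lemma IsClassicalIdealGas.acceleration_eq_zero (hg : IsClassicalIdealGas k cv u ρ p n ε s Θ U)
    (hU : IsOpen U) {H : Spacetime → ℝ} (h : IsShearFree (lower u) ψ H U)
    (hθ : ∀ x ∈ U, expansion u x = 3 * H x) (hH0 : ∀ x ∈ U, H x ≠ 0)
    (hD : ∀ x ∈ U, ∀ μ ν, pd μ (lower u ν) x = H x * eta μ ν - lower u μ x * pd ν ψ x)
    {x : Spacetime} (hx : x ∈ U) (ν : Fin 4) : pd ν ψ x + H x * lower u ν x = 0 := by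
  have hk := hg.k_pos
  have hcv := hg.cv_pos
  have hT0 := fun x (hx : x ∈ U) => hg.temp_ne_zero hx
  have hw : ContDiffOn ℝ ∞ (fun y => (Θ y)⁻¹) U := hg.smooth_temp.inv hT0
  have hL : ContDiffOn ℝ ∞ (fun y => Real.log (p y)) U :=
    hg.smooth_p.log fun x hx => (hg.p_pos x hx).ne'
  have hua : ∀ x ∈ U, ∀ ν, ∑ μ, u x μ * pd μ (lower u ν) x = H x * lower u ν x + pd ν ψ x := by
    intro x hx ν
    have e : ∑ μ, u x μ * pd μ (lower u ν) x = H x * (∑ μ, u x μ * eta μ ν)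
        - (∑ μ, eta μ μ * lower u μ x * lower u μ x) * pd ν ψ x := by
      rw [Finset.mul_sum, Finset.sum_mul, ← Finset.sum_sub_distrib]
      exact Finset.sum_congr rfl fun μ _ => by rw [hD x hx, eta_mul_lower]; ring
    rw [e, h.unit x hx,
      Finset.sum_eq_single ν (fun b _ hb => by simp [eta_apply b ν, hb]) (by simp), lower]
    ring
  -- The pressure gradient divided by p = knΘ: the factor multiplying the acceleration becomes
  -- affine in 1/Θ.
  have hLν : ∀ x ∈ U, ∀ ν, k * pd ν (fun y => Real.log (p y)) x =
      3 * k * (cv + k) / cv * (H x * lower u ν x)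
        - ((Θ x)⁻¹ + (cv + k)) * (pd ν ψ x + H x * lower u ν x) := by
    intro x hx ν
    have hp0 := (hg.p_pos x hx).ne'
    have hn0 := hg.density_ne_zero hx
    have ht0 := hT0 x hx
    rw [((hasPd_of_contDiffOn hg.smooth_p hU hx).log hp0).2]
    beta_reduce
    rw [(hg.pd_eqs hU hx).2, hua x hx, hθ x hx,
      hg.state_p x hx]
    field_simp
    ring
  have hwu : ∀ x ∈ U, ∑ μ, u x μ * pd μ (fun y => (Θ y)⁻¹) x =
      3 * k / cv * (H x * (Θ x)⁻¹) := by
    intro x hx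
    have ht0 := hT0 x hx
    have h1 := (hg.pd_eqs hU hx).1
    have e : ∑ μ, u x μ * pd μ (fun y => (Θ y)⁻¹) x =
        -(Θ x ^ 2)⁻¹ * ∑ μ, u x μ * pd μ Θ x := by
      rw [Finset.mul_sum]
      refine Finset.sum_congr rfl fun μ _ => ?_
      rw [((hasPd_of_contDiffOn hg.smooth_temp hU hx).inv ht0).2]; ring
    rw [e]
    rw [hθ x hx] at h1
    field_simp
    linear_combination -h1
  have hcurl : ∀ x ∈ U, ∀ ν, (3 * k * (cv + k) / cv - (cv + k) - (1 + 3 * k / cv) * (Θ x)⁻¹) *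
      (pd ν ψ x + H x * lower u ν x) = 0 := by
    intro x hx
    have hw' := hasPd_of_contDiffOn hw hU hx
    have hH' := hasPd_of_contDiffOn h.smooth_H hU hx
    have hv' := fun ν => hasPd_of_contDiffOn (h.smooth_v ν) hU hx
    have hψ' := fun ν => hasPd_of_contDiffOn (contDiffOn_pd h.smooth_psi hU ν) hU hx
    have hL' := fun ν => hasPd_of_contDiffOn (contDiffOn_pd hL hU ν) hU hx
    have h2 : ∀ μ ν, k * pd μ (pd ν (fun y => Real.log (p y))) x =
        3 * k * (cv + k) / cv * (pd μ H x * lower u ν x + H x * pd μ (lower u ν) x)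
        - (pd μ (fun y => (Θ y)⁻¹) x * (pd ν ψ x + H x * lower u ν x) + ((Θ x)⁻¹ + (cv + k)) *
          (pd μ (pd ν ψ) x + (pd μ H x * lower u ν x + H x * pd μ (lower u ν) x))) := by
      intro μ ν
      have e := (((hH'.mul (hv' ν)).const_mul (3 * k * (cv + k) / cv)).sub
        ((hw'.add (hasPd_const (cv + k))).mul ((hψ' ν).add (hH'.mul (hv' ν))))).2 μ
      simp only [add_zero] at e
      exact (((hL' ν).const_mul k).2 μ).symm.trans
        ((pd_congr hU hx (fun y hy => hLν y hy ν) μ).trans e)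
    have hsL := pd_comm hL hU hx
    have hsψ := pd_comm h.smooth_psi hU hx
    have hHα := h.exists_pd_H hU hD hx
    have hDx := hD x hx
    have hwx := hwu x hx
    have hr := h.rate x hx
    have hunit := h.unit x hx
    have hH0x := hH0 x hx
    set B := ∑ μ, eta μ μ * pd μ (pd μ ψ) x
    set w := (Θ x)⁻¹
    set c := 3 * k * (cv + k) / cv
    have hsη : ∀ μ ν, eta μ ν = eta ν μ := fun μ ν => by simp only [eta_apply]; grind
    -- Antisymmetrised second derivatives of log p. Those of ψ cancel, dH ∧ v = 0 by `exists_pd_H`,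
    -- and the curl of v is expressed by v ∧ dψ.
    have h3 : ∀ μ ν, (c - w - (cv + k)) * H x *
        (lower u ν x * pd μ ψ x - lower u μ x * pd ν ψ x) =
        pd μ (fun y => (Θ y)⁻¹) x * (pd ν ψ x + H x * lower u ν x)
        - pd ν (fun y => (Θ y)⁻¹) x * (pd μ ψ x + H x * lower u μ x) := by
      intro μ ν
      have a := h2 μ ν
      have b := h2 ν μ
      rw [hsL, hsψ] at a
      have g := hHα μ
      have g' := hHα ν
      rw [hDx] at a b
      rw [hsη μ ν] at a
      linear_combination b - a + (c - w - (cv + k)) / 2 * (lower u μ x * g' - lower u ν x * g)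
    intro ν
    -- Contraction with u: the acceleration is orthogonal to u, and `hwu` evaluates u(1/Θ).
    have h4 : ∑ μ, u x μ * ((c - w - (cv + k)) * H x *
        (lower u ν x * pd μ ψ x - lower u μ x * pd ν ψ x)) =
        ∑ μ, u x μ * (pd μ (fun y => (Θ y)⁻¹) x * (pd ν ψ x + H x * lower u ν x)
        - pd ν (fun y => (Θ y)⁻¹) x * (pd μ ψ x + H x * lower u μ x)) :=
      Finset.sum_congr rfl fun μ _ => by rw [h3]
    simp only [eta_mul_lower] at hr hunit
    simp only [Fin.sum_univ_four] at h4 hr hunit hwx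
    apply mul_left_cancel₀ hH0x
    set W := pd ν (fun y => (Θ y)⁻¹) x
    set a := pd ν ψ x + H x * lower u ν x with ha
    linear_combination h4 + a * hwx - (c - w - (cv + k)) * H x * lower u ν x * hr
      + (c - w - (cv + k)) * H x * pd ν ψ x * hunit - W * hr - W * H x * hunit
  by_contra hne
  have ha : ContinuousOn (fun y => pd ν ψ y + H y * lower u ν y) U :=
    ((contDiffOn_pd h.smooth_psi hU ν).add (h.smooth_H.mul (h.smooth_v ν))).continuousOn
  -- On the open set where this component of the acceleration is non-zero, `hcurl` makes 1/Θ
  -- constant, contradicting `hwu`.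
  set O := U ∩ (fun y => pd ν ψ y + H y * lower u ν y) ⁻¹' {0}ᶜ with hO
  have hOo : IsOpen O := ha.isOpen_inter_preimage hU isOpen_compl_singleton
  have hxO : x ∈ O := ⟨hx, hne⟩
  have hpos : 0 < 1 + 3 * k / cv := by positivity
  have hconst : ∀ y ∈ O, (Θ y)⁻¹ = (3 * k * (cv + k) / cv - (cv + k)) / (1 + 3 * k / cv) := by
    intro y hy
    have := (mul_eq_zero.1 (hcurl y hy.1 ν)).resolve_right hy.2
    rw [eq_div_iff hpos.ne']
    linarith
  have h5 := hwu x hx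
  simp only [(HasPd.congr hOo hxO hconst (hasPd_const _)).2, mul_zero, Finset.sum_const_zero] at h5
  have h6 : 3 * k / cv * (H x * (Θ x)⁻¹) ≠ 0 :=
    mul_ne_zero (by positivity) (mul_ne_zero (hH0 x hx) (inv_ne_zero (hT0 x hx)))
  exact h6 h5.symm

/-- Riccati equation for the expansion of a geodesic irrotational shear-free congruence. -/
lemma IsShearFree.pd_H_eq {v : Fin 4 → Spacetime → ℝ} {H : Spacetime → ℝ}
    (h : IsShearFree v ψ H U) (hU : IsOpen U)
    (hD : ∀ x ∈ U, ∀ μ ν, pd μ (v ν) x = H x * eta μ ν - v μ x * pd ν ψ x)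
    (ha : ∀ x ∈ U, ∀ ν, pd ν ψ x + H x * v ν x = 0) {x : Spacetime} (hx : x ∈ U) (α : Fin 4) :
    pd α H x = H x ^ 2 * v α x := by
  have hH := hasPd_of_contDiffOn h.smooth_H hU hx
  have hv := fun ν => hasPd_of_contDiffOn (h.smooth_v ν) hU hx
  have h1 := h.exists_pd_H hU hD hx
  have hψ : ∀ y ∈ U, ∀ ν, pd ν ψ y = -1 * (H y * v ν y) := fun y hy ν => by linarith [ha y hy ν]
  have h2 : ∀ μ, pd μ (pd μ ψ) x = -1 * (pd μ H x * v μ x + H x * pd μ (v μ) x) := fun μ =>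
    (pd_congr hU hx (fun y hy => hψ y hy μ) μ).trans ((((hH.mul (hv μ)).const_mul (-1)).2 μ))
  have hu := h.unit x hx
  set B := ∑ μ, eta μ μ * pd μ (pd μ ψ) x with hB
  -- From dψ = -H v one has B = -u(H) - 3H², while `exists_pd_H` contracted with u gives u(H) = B/2.
  have h3 : B = -2 * H x ^ 2 := by
    have e : ∀ μ, eta μ μ * pd μ (pd μ ψ) x =
        (B / 2 - H x ^ 2) * (eta μ μ * v μ x * v μ x) - H x ^ 2 := by
      intro μ
      rw [h2, hD x hx, hψ x hx]
      linear_combination (-(eta μ μ * v μ x) / 2) * h1 μ - H x ^ 2 * eta_self_mul_self μ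
    have e2 : B = ∑ μ, ((B / 2 - H x ^ 2) * (eta μ μ * v μ x * v μ x) - H x ^ 2) :=
      Finset.sum_congr rfl fun μ _ => e μ
    rw [Finset.sum_sub_distrib, ← Finset.mul_sum, hu] at e2
    simp at e2
    linarith
  have h4 := h1 α
  rw [h3] at h4
  linarith

lemma eq_zero_of_eq_zero_of_coord_ne_zero (hU : IsOpen U) {f : Spacetime → ℝ}
    (hf : ContinuousOn f U) (h0 : ∀ x ∈ U, x 1 ≠ 0 → f x = 0) : ∀ x ∈ U, f x = 0 := by
  intro x hx
  by_contra hne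
  have ho : IsOpen (U ∩ f ⁻¹' {0}ᶜ) := hf.isOpen_inter_preimage hU isOpen_compl_singleton
  have hd : Dense ((fun y : Spacetime => y 1) ⁻¹' {0}ᶜ) :=
    (dense_compl_singleton (0 : ℝ)).preimage (isOpenMap_eval (1 : Fin 4))
  obtain ⟨y, hy, hy1⟩ := hd.inter_open_nonempty _ ho ⟨x, hx, hne⟩
  exact hy.2 (h0 y hy.1 hy1)

lemma eq_zero_of_mul_coord_eq (hU : IsOpen U) (hne : U.Nonempty) {a b : ℝ} {i j : Fin 4}
    (hij : i ≠ j) (h : ∀ x ∈ U, a * x j = b * x i) : a = 0 := by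
  obtain ⟨x, hx⟩ := hne
  have h1 := ((hasPd_coord (x := x) j).const_mul a).2 j
  have h2 := ((hasPd_coord (x := x) i).const_mul b).2 j
  have h3 := h1.symm.trans ((pd_congr hU hx h j).trans h2)
  simpa [hij.symm] using h3

/-- A radial conformally stationary flow of a classical ideal gas with non-zero expansion consists
of straight lines through an event on the axis. -/
lemma exists_eq_smul_positionFrom (hU : IsOpen U) (hconn : IsPreconnected U) (hne : U.Nonempty)
    (hu : IsRadialConformallyStationary u U) (hθ : ∀ x ∈ U, expansion u x ≠ 0)
    (hg : IsCIGFlow u U) :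
    ∃ t₀ : ℝ, ∀ x ∈ U, u x = (expansion u x / 3) • positionFrom t₀ x := by
  obtain ⟨hvel, hrad, hstat⟩ := hu
  obtain ⟨k, cv, ρ, p, n, ε, s, Θ, hg⟩ := hg
  obtain ⟨ψ, hS⟩ := hstat.isShearFree hU hvel
  set H : Spacetime → ℝ := fun x => expansion u x / 3 with hH
  have hH0 : ∀ x ∈ U, H x ≠ 0 := fun x hx => div_ne_zero (hθ x hx) (by norm_num)
  have hrad' : ∀ x ∈ U, ∃ b : ℝ, ∀ i : Fin 4, i ≠ 0 → u x i = b * x i := by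
    intro x hx
    obtain ⟨b, hb⟩ := hrad x hx
    refine ⟨b, fun i hi => ?_⟩
    obtain ⟨j, rfl⟩ := Fin.exists_succ_eq.2 hi
    exact hb j
  have hlow : ∀ x, ∀ i : Fin 4, i ≠ 0 → lower u i x = u x i := fun x i hi => by
    simp [lower, eta_apply, hi]
  -- The rotation argument needs r ≠ 0. The set x¹ ≠ 0 avoids the axis and is dense, so identities
  -- between continuous functions extend from W to U.
  set W : Set Spacetime := U ∩ {x | x 1 ≠ 0} with hW
  have hWo : IsOpen W := hU.inter (isOpen_ne_fun (continuous_apply 1) continuous_const)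
  have hWU : W ⊆ U := Set.inter_subset_left
  have hSW := hS.mono hWU
  have hgW : IsClassicalIdealGas k cv u ρ p n ε s Θ W :=
    { k_pos := hg.k_pos
      cv_pos := hg.cv_pos
      unit_velocity := ⟨hvel.1.mono hWU, fun x hx => hvel.2 x (hWU hx)⟩
      smooth_rho := hg.smooth_rho.mono hWU
      smooth_p := hg.smooth_p.mono hWU
      smooth_n := hg.smooth_n.mono hWU
      smooth_eps := hg.smooth_eps.mono hWU
      smooth_s := hg.smooth_s.mono hWU
      smooth_temp := hg.smooth_temp.mono hWU
      conservation := fun x hx => hg.conservation x (hWU hx)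
      decomposition := fun x hx => hg.decomposition x (hWU hx)
      matter := fun x hx => hg.matter x (hWU hx)
      lte := fun x hx => hg.lte x (hWU hx)
      state_p := fun x hx => hg.state_p x (hWU hx)
      p_pos := fun x hx => hg.p_pos x (hWU hx)
      state_eps := fun x hx => hg.state_eps x (hWU hx) }
  have hD : ∀ x ∈ W, ∀ μ ν, pd μ (lower u ν) x = H x * eta μ ν - lower u μ x * pd ν ψ x := by
    intro x hx
    refine hSW.pd_eq_of_radial hWo (fun y hy => ?_) hx ?_ ?_
    · obtain ⟨b, hb⟩ := hrad' y (hWU hy)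
      exact ⟨b, fun i hi => by rw [hlow y i hi, hb i hi]⟩
    · have := (hvel.2 x (hWU hx)).2
      simp [lower, eta_apply, this.ne']
    · have := sq_pos_of_ne_zero hx.2
      positivity
  have ha : ∀ x ∈ W, ∀ ν, pd ν ψ x + H x * lower u ν x = 0 := fun x hx ν =>
    hgW.acceleration_eq_zero hWo hSW (fun y _ => by rw [hH]; ring) (fun y hy => hH0 y (hWU hy))
      hD hx ν
  have hHd := fun x (hx : x ∈ W) => hSW.pd_H_eq hWo hD ha hx
  have hf : ∀ ν, ContDiffOn ℝ ∞ (fun x : Spacetime => x ν - u x ν * (H x)⁻¹) U := fun ν =>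
    (contDiff_apply ℝ ℝ ν).contDiffOn.sub
      ((contDiffOn_pi.1 hvel.1 ν).mul (hS.smooth_H.inv hH0))
  -- The point x - u/H is the candidate for the common event. Its derivative is computed on W but
  -- must vanish on all of U: W may be disconnected, while U is not.
  have hpd : ∀ μ ν, ∀ x ∈ U, pd μ (fun x : Spacetime => x ν - u x ν * (H x)⁻¹) x = 0 := by
    intro μ ν
    refine eq_zero_of_eq_zero_of_coord_ne_zero hU (contDiffOn_pd (hf ν) hU μ).continuousOn
      fun x hx hx1 => ?_
    have hxW : x ∈ W := ⟨hx, hx1⟩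
    have h0 := hH0 x hx
    have h1 := (hasPd_of_contDiffOn (hS.smooth_v ν) hU hx).const_mul (eta ν ν)
    simp only [eta_mul_lower] at h1
    rw [((hasPd_coord ν).sub
      (h1.mul ((hasPd_of_contDiffOn hS.smooth_H hU hx).inv h0))).2 μ]
    beta_reduce
    have h2 : pd ν ψ x = -(H x * lower u ν x) := by linarith [ha x hxW ν]
    have h3 : (if μ = ν then 1 else 0) = eta ν ν * eta μ ν := by
      split_ifs with h
      · rw [h, eta_self_mul_self]
      · simp [eta_apply μ ν, h]
    rw [hD x hxW, hHd x hxW, h2, h3, ← eta_mul_lower u ν x]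
    field_simp
    ring
  have hc : ∀ ν, ∃ c, ∀ x ∈ U, x ν - u x ν * (H x)⁻¹ = c := fun ν =>
    exists_const_of_pd_eq_zero hU hconn fun x hx =>
      ⟨(hasPd_of_contDiffOn (hf ν) hU hx).1, fun μ => hpd μ ν x hx⟩
  choose c hc using hc
  have huc : ∀ x ∈ U, ∀ ν, u x ν = H x * (x ν - c ν) := by
    intro x hx ν
    rw [← hc ν x hx]
    field_simp [hH0 x hx]
    ring
  -- Radiality gives c_i x_j = c_j x_i on an open set, so the event lies on the axis.
  have hzero : ∀ i j : Fin 4, i ≠ 0 → j ≠ 0 → i ≠ j → c i = 0 := by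
    intro i j hi hj hij
    refine eq_zero_of_mul_coord_eq hU hne hij (b := c j) fun x hx => ?_
    obtain ⟨b, hb⟩ := hrad' x hx
    have h1 := huc x hx i
    have h2 := huc x hx j
    rw [hb i hi] at h1
    rw [hb j hj] at h2
    apply mul_left_cancel₀ (hH0 x hx)
    linear_combination x j * h1 - x i * h2
  refine ⟨c 0, fun x hx => ?_⟩
  have h1 := hzero 1 2 (by decide) (by decide) (by decide)
  have h2 := hzero 2 1 (by decide) (by decide) (by decide)
  have h3 := hzero 3 1 (by decide) (by decide) (by decide)
  ext ν
  rw [huc x hx ν]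
  fin_cases ν <;> simp [positionFrom, hH, h1, h2, h3]

end

/-! ### Milne congruences and their ideal gases. -/

section

variable {u : Spacetime → Fin 4 → ℝ} {U : Set Spacetime} {t₀ σ : ℝ} {x : Spacetime}

/-- The proper time between the event `(t₀, 0, 0, 0)` and `x`. -/
def properTime (t₀ : ℝ) (x : Spacetime) : ℝ := Real.sqrt ((x 0 - t₀) ^ 2 - radius x ^ 2)

lemma radius_nonneg (x : Spacetime) : 0 ≤ radius x := Real.sqrt_nonneg _

lemma radius_sq (x : Spacetime) : radius x ^ 2 = x 1 ^ 2 + x 2 ^ 2 + x 3 ^ 2 :=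
  Real.sq_sqrt (by positivity)

/-- The congruence of straight lines through `(t₀, 0, 0, 0)`: expanding for `σ = 1`, contracting
for `σ = -1`. -/
def IsSignedMilne (σ t₀ : ℝ) (u : Spacetime → Fin 4 → ℝ) (U : Set Spacetime) : Prop :=
  ∀ x ∈ U, radius x < σ * (x 0 - t₀) ∧
    u x = (σ * (properTime t₀ x)⁻¹) • positionFrom t₀ x

lemma isSignedMilne_one : IsSignedMilne 1 t₀ u U ↔ IsMilne t₀ u U := by
  simp [IsSignedMilne, IsMilne, properTime]

lemma isSignedMilne_neg_one : IsSignedMilne (-1) t₀ u U ↔ IsContractingMilne t₀ u U := by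
  simp [IsSignedMilne, IsContractingMilne, properTime]

lemma sq_radius_lt (hσ : σ ^ 2 = 1) (h : radius x < σ * (x 0 - t₀)) :
    0 < (x 0 - t₀) ^ 2 - radius x ^ 2 := by
  have h0 := radius_nonneg x
  have : (σ * (x 0 - t₀)) ^ 2 = (x 0 - t₀) ^ 2 := by rw [mul_pow, hσ, one_mul]
  rw [← this]
  nlinarith

lemma properTime_pos (hσ : σ ^ 2 = 1) (h : radius x < σ * (x 0 - t₀)) : 0 < properTime t₀ x :=
  Real.sqrt_pos.2 (sq_radius_lt hσ h)

lemma sum_positionFrom_sq (t₀ : ℝ) (x : Spacetime) :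
    ∑ μ, eta μ μ * positionFrom t₀ x μ * positionFrom t₀ x μ =
      -((x 0 - t₀) ^ 2 - radius x ^ 2) := by
  rw [radius_sq]
  simp [Fin.sum_univ_four, eta_apply, positionFrom]
  ring

lemma properTime_eq (t₀ : ℝ) (x : Spacetime) : properTime t₀ x =
    Real.sqrt (-∑ μ, eta μ μ * positionFrom t₀ x μ * positionFrom t₀ x μ) := by
  rw [sum_positionFrom_sq, neg_neg, properTime]

lemma sum_positionFrom_sq_eq (hσ : σ ^ 2 = 1) (h : radius x < σ * (x 0 - t₀)) :
    ∑ μ, eta μ μ * positionFrom t₀ x μ * positionFrom t₀ x μ = -properTime t₀ x ^ 2 := by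
  rw [properTime, Real.sq_sqrt (sq_radius_lt hσ h).le, sum_positionFrom_sq]

lemma hasPd_positionFrom (ν : Fin 4) :
    HasPd (fun y => positionFrom t₀ y ν) (fun μ => if μ = ν then 1 else 0) x := by
  simpa [positionFrom] using (hasPd_coord (x := x) ν).sub
    (hasPd_const ((Pi.single 0 t₀ : Spacetime) ν))

lemma contDiff_positionFrom (ν : Fin 4) : ContDiff ℝ ∞ fun y => positionFrom t₀ y ν :=
  (contDiff_apply ℝ ℝ ν).sub contDiff_const

lemma contDiffOn_properTime (hσ : σ ^ 2 = 1) (h : ∀ x ∈ U, radius x < σ * (x 0 - t₀)) :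
    ContDiffOn ℝ ∞ (properTime t₀) U := by
  have h1 : properTime t₀ = fun x =>
    Real.sqrt (-∑ μ, eta μ μ * positionFrom t₀ x μ * positionFrom t₀ x μ) :=
    funext (properTime_eq t₀)
  rw [h1]
  refine ContDiffOn.sqrt (ContDiff.contDiffOn ?_) fun x hx => ?_
  · exact (ContDiff.sum fun μ _ => (contDiff_const.mul (contDiff_positionFrom μ)).mul
      (contDiff_positionFrom μ)).neg
  · rw [sum_positionFrom_sq, neg_neg]
    exact (sq_radius_lt hσ (h x hx)).ne'

lemma hasPd_properTime (hσ : σ ^ 2 = 1) (h : radius x < σ * (x 0 - t₀)) :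
    HasPd (properTime t₀) (fun μ => -(eta μ μ * positionFrom t₀ x μ) / properTime t₀ x) x := by
  have h1 : properTime t₀ = fun x =>
    Real.sqrt (-1 * ∑ μ, eta μ μ * positionFrom t₀ x μ * positionFrom t₀ x μ) :=
    funext fun x => by rw [properTime_eq, neg_one_mul]
  have hq := (HasPd.sum (x := x) Finset.univ fun ν _ => ((hasPd_positionFrom (t₀ := t₀) ν).const_mul
    (eta ν ν)).mul (hasPd_positionFrom (t₀ := t₀) ν)).const_mul (-1)
  have hne : -1 * ∑ μ, eta μ μ * positionFrom t₀ x μ * positionFrom t₀ x μ ≠ 0 := by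
    rw [sum_positionFrom_sq, neg_one_mul, neg_neg]
    exact (sq_radius_lt hσ h).ne'
  have h2 := hq.comp (Real.hasDerivAt_sqrt hne)
  have hp := (properTime_pos hσ h).ne'
  refine ⟨h1 ▸ h2.1, fun μ => ?_⟩
  have h3 := h2.2 μ
  have h4 := congrFun h1 x
  beta_reduce at h4
  rw [← h1, ← h4] at h3
  rw [h3]
  simp only [mul_ite, ite_mul, mul_one, mul_zero, zero_mul, Finset.sum_add_distrib,
    Finset.sum_ite_eq, Finset.mem_univ, if_true]
  field_simp
  ring

/-- Euler's identity: τ is homogeneous of degree one in the position vector. -/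
lemma sum_mul_hasPd_properTime (hσ : σ ^ 2 = 1) (h : radius x < σ * (x 0 - t₀)) :
    ∑ μ, pd μ (properTime t₀) x * positionFrom t₀ x μ = properTime t₀ x := by
  have hp := (properTime_pos hσ h).ne'
  simp only [(hasPd_properTime hσ h).2]
  have e : ∑ μ, -(eta μ μ * positionFrom t₀ x μ) / properTime t₀ x * positionFrom t₀ x μ =
      -(properTime t₀ x)⁻¹ * ∑ μ, eta μ μ * positionFrom t₀ x μ * positionFrom t₀ x μ := by
    rw [Finset.mul_sum]; exact Finset.sum_congr rfl fun μ _ => by ring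
  rw [e, sum_positionFrom_sq_eq hσ h]
  field_simp

/-- The divergence of `f(τ) X`, where `τ` is the proper time and `X` the position vector. -/
lemma sum_pd_mul_positionFrom (hσ : σ ^ 2 = 1) (h : radius x < σ * (x 0 - t₀))
    {f : Spacetime → ℝ} {f' : ℝ} (hf : HasPd f (fun μ => f' * pd μ (properTime t₀) x) x) :
    ∑ μ, pd μ (fun y => f y * positionFrom t₀ y μ) x = f' * properTime t₀ x + 4 * f x := by
  have h1 : ∀ μ, pd μ (fun y => f y * positionFrom t₀ y μ) x =
      f' * (pd μ (properTime t₀) x * positionFrom t₀ x μ) + f x := by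
    intro μ
    rw [(hf.mul (hasPd_positionFrom μ)).2 μ]
    simp; ring
  simp only [h1]
  rw [Finset.sum_add_distrib, ← Finset.mul_sum, sum_mul_hasPd_properTime hσ h]
  simp

lemma IsSignedMilne.properTime_pos (hσ : σ ^ 2 = 1) (hM : IsSignedMilne σ t₀ u U) (hx : x ∈ U) :
    0 < properTime t₀ x := Minkowski.properTime_pos hσ (hM x hx).1

lemma IsSignedMilne.isUnitVelocity (hσ : σ ^ 2 = 1) (hM : IsSignedMilne σ t₀ u U) :
    IsUnitVelocity u U := by
  refine ⟨?_, fun x hx => ⟨?_, ?_⟩⟩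
  · refine contDiffOn_pi.2 fun ν => ?_
    have h1 : ContDiffOn ℝ ∞ (fun x => σ * (properTime t₀ x)⁻¹ * positionFrom t₀ x ν) U :=
      (contDiffOn_const.mul ((contDiffOn_properTime hσ fun x hx => (hM x hx).1).inv
        fun x hx => (hM.properTime_pos hσ hx).ne')).mul (contDiff_positionFrom ν).contDiffOn
    exact h1.congr fun x hx => by rw [(hM x hx).2]; rfl
  · have hp := (hM.properTime_pos hσ hx).ne'
    rw [metric_eq, (hM x hx).2]
    have : ∀ μ, eta μ μ * ((σ * (properTime t₀ x)⁻¹) • positionFrom t₀ x) μ *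
        ((σ * (properTime t₀ x)⁻¹) • positionFrom t₀ x) μ = ((properTime t₀ x)⁻¹) ^ 2 *
          (eta μ μ * positionFrom t₀ x μ * positionFrom t₀ x μ) := by
      intro μ
      simp only [Pi.smul_apply, smul_eq_mul]
      linear_combination ((properTime t₀ x)⁻¹) ^ 2 *
          (eta μ μ * positionFrom t₀ x μ * positionFrom t₀ x μ) * hσ
    simp only [this]
    rw [← Finset.mul_sum, sum_positionFrom_sq_eq hσ (hM x hx).1]
    field_simp
  · have hp := hM.properTime_pos hσ hx
    have h1 := (hM x hx).1
    have h2 := radius_nonneg x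
    rw [(hM x hx).2]
    have : ((σ * (properTime t₀ x)⁻¹) • positionFrom t₀ x) 0 =
        (properTime t₀ x)⁻¹ * (σ * (x 0 - t₀)) := by
      simp [positionFrom]; ring
    rw [this]
    exact mul_pos (inv_pos.2 hp) (by linarith)

/-- The position vector X generates dilations, L_X g = 2g; so ξ = σX is conformal Killing with l =
σ. -/
lemma IsSignedMilne.isRadialConformallyStationary (hσ : σ ^ 2 = 1)
    (hM : IsSignedMilne σ t₀ u U) : IsRadialConformallyStationary u U := by
  refine ⟨hM.isUnitVelocity hσ, fun x hx => ⟨σ * (properTime t₀ x)⁻¹, fun i => ?_⟩,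
    fun x => σ • positionFrom t₀ x, ⟨?_, fun _ => σ, fun x _ μ ν => ?_⟩, fun x hx => ?_⟩
  · rw [(hM x hx).2]
    simp [positionFrom]
  · exact contDiffOn_pi.2 fun ν =>
      (contDiff_const.mul (contDiff_positionFrom ν)).contDiffOn
  · rw [lieMetric_eq]
    have h1 : ∀ μ ν : Fin 4, pd μ (fun y => (σ • positionFrom t₀ y) ν) x =
        σ * if μ = ν then 1 else 0 := fun μ ν => ((hasPd_positionFrom ν).const_mul σ).2 μ
    rw [h1, h1]
    by_cases h : μ = ν
    · subst h; simp; ring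
    · simp [h, Ne.symm h, eta_apply]
  · have hp := hM.properTime_pos hσ hx
    have hm : metric (σ • positionFrom t₀ x) (σ • positionFrom t₀ x) = -properTime t₀ x ^ 2 := by
      rw [← sum_positionFrom_sq_eq hσ (hM x hx).1, metric_eq]
      refine Finset.sum_congr rfl fun μ _ => ?_
      simp only [Pi.smul_apply, smul_eq_mul]
      linear_combination (eta μ μ * positionFrom t₀ x μ * positionFrom t₀ x μ) * hσ
    refine ⟨by rw [hm]; exact neg_neg_of_pos (by positivity), ?_⟩
    rw [(hM x hx).2, modulus, hm, neg_neg, Real.sqrt_sq hp.le, smul_smul, mul_comm]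

lemma IsSignedMilne.expansion_eq (hU : IsOpen U) (hσ : σ ^ 2 = 1) (hM : IsSignedMilne σ t₀ u U)
    (hx : x ∈ U) : expansion u x = 3 * σ / properTime t₀ x := by
  have hp := (hM.properTime_pos hσ hx).ne'
  have hτ := (hasPd_properTime hσ (hM x hx).1).1.hasPd
  have hf : HasPd (fun y => σ * (properTime t₀ y)⁻¹)
      (fun μ => (-σ * (properTime t₀ x ^ 2)⁻¹) * pd μ (properTime t₀) x) x := by
    convert (hτ.inv hp).const_mul σ using 2
    ring
  have h1 := sum_pd_mul_positionFrom hσ (hM x hx).1 hf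
  have h2 : expansion u x =
      ∑ μ, pd μ (fun y => σ * (properTime t₀ y)⁻¹ * positionFrom t₀ y μ) x := by
    rw [expansion, divergence]
    exact Finset.sum_congr rfl fun μ _ =>
      pd_congr hU hx (fun y hy => by rw [(hM y hy).2]; rfl) μ
  rw [h2, h1]
  field_simp
  ring

/-- A congruence of straight lines through an event is the flow of a classical ideal gas in
homogeneous adiabatic evolution, with `n = τ⁻³` and `Θ = τ^(-3 k / c_v)`. -/
lemma IsSignedMilne.isClassicalIdealGas (hU : IsOpen U) (hσ : σ ^ 2 = 1)
    (hM : IsSignedMilne σ t₀ u U) {k cv : ℝ} (hk : 0 < k) (hcv : 0 < cv) :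
    ∃ ρ p n ε s Θ : Spacetime → ℝ,
      IsClassicalIdealGas k cv u ρ p n ε s Θ U ∧ ∀ x ∈ U, 0 < n x ∧ 0 < Θ x := by
  set τ := properTime t₀ with hτdef
  -- The entropy is constant exactly when c_v d log Θ = k d log n; with n = τ⁻³ this fixes the
  -- exponent, and s = 0 can serve below.
  set a : ℝ := -3 * k / cv with ha
  have hpos : ∀ x ∈ U, 0 < τ x := fun x hx => hM.properTime_pos hσ hx
  have hτs : ContDiffOn ℝ ∞ τ U := contDiffOn_properTime hσ fun x hx => (hM x hx).1
  set n : Spacetime → ℝ := fun x => (τ x ^ 3)⁻¹ with hn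
  set Θ : Spacetime → ℝ := fun x => τ x ^ a with hΘ
  have hns : ContDiffOn ℝ ∞ n U := (hτs.pow 3).inv fun x hx => (pow_pos (hpos x hx) 3).ne'
  have hΘs : ContDiffOn ℝ ∞ Θ U := hτs.rpow_const_of_ne fun x hx => (hpos x hx).ne'
  have hnpos : ∀ x ∈ U, 0 < n x := fun x hx => inv_pos.2 (pow_pos (hpos x hx) 3)
  have hΘpos : ∀ x ∈ U, 0 < Θ x := fun x hx => Real.rpow_pos_of_pos (hpos x hx) a
  have hτ : ∀ x ∈ U, HasPd τ (fun μ => pd μ τ x) x := fun x hx => hasPd_of_contDiffOn hτs hU hx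
  have hnd : ∀ x ∈ U, HasPd n (fun μ => (-3 * n x / τ x) * pd μ τ x) x := by
    intro x hx
    have h0 := (hpos x hx).ne'
    have h1 := (((hτ x hx).comp (hasDerivAt_pow 3 (τ x)))).inv (pow_ne_zero 3 h0)
    convert h1 using 2
    simp only [hn]
    push_cast
    field_simp
  have hΘd : ∀ x ∈ U, HasPd Θ (fun μ => (a * Θ x / τ x) * pd μ τ x) x := by
    intro x hx
    have h0 := (hpos x hx).ne'
    have h1 := (hτ x hx).comp (Real.hasDerivAt_rpow_const (p := a) (Or.inl h0))
    convert h1 using 3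
    rw [Real.rpow_sub_one h0]
    ring
  refine ⟨fun x => n x * (1 + cv * Θ x), fun x => k * n x * Θ x, n, fun x => cv * Θ x, fun _ => 0,
    Θ, ?_, fun x hx => ⟨hnpos x hx, hΘpos x hx⟩⟩
  refine ⟨hk, hcv, hM.isUnitVelocity hσ, hns.mul (contDiffOn_const.add (contDiffOn_const.mul hΘs)),
    (contDiffOn_const.mul hns).mul hΘs, hns, contDiffOn_const.mul hΘs, contDiffOn_const, hΘs,
    ?_, fun _ _ => rfl, ?_, ?_, fun _ _ => rfl, ?_, fun _ _ => rfl⟩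
  · intro x hx ν
    have h0 := (hpos x hx).ne'
    have hτ2 : HasPd (fun y => (τ y ^ 2)⁻¹) (fun μ => (-2 * (τ x ^ 3)⁻¹) * pd μ τ x) x := by
      have h1 := (((hτ x hx).comp (hasDerivAt_pow 2 (τ x)))).inv (pow_ne_zero 2 h0)
      convert h1 using 2
      push_cast
      field_simp
    have hE : HasPd (fun y => n y * (1 + (cv + k) * Θ y) * (τ y ^ 2)⁻¹)
        (fun μ => ((-5 * (n x * (1 + (cv + k) * Θ x)) + n x * (cv + k) * a * Θ x) *
          (τ x ^ 3)⁻¹) * pd μ τ x) x := by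
      have h1 := ((hnd x hx).mul ((hasPd_const 1).add ((hΘd x hx).const_mul (cv + k)))).mul hτ2
      convert h1 using 2
      field_simp
      ring
    have hp : HasPd (fun y => k * n y * Θ y)
        (fun μ => (k * n x * Θ x * (a - 3) / τ x) * pd μ τ x) x := by
      have h1 := ((hnd x hx).const_mul k).mul (hΘd x hx)
      convert h1 using 2
      ring
    have hT : ∀ μ, pd μ (fun y => energyTensor u (fun x => n x * (1 + cv * Θ x))
        (fun x => k * n x * Θ x) y μ ν) x =
        pd μ (fun y => n y * (1 + (cv + k) * Θ y) * (τ y ^ 2)⁻¹ * positionFrom t₀ y μ) x *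
          positionFrom t₀ x ν + n x * (1 + (cv + k) * Θ x) * (τ x ^ 2)⁻¹ * positionFrom t₀ x μ *
          (if μ = ν then 1 else 0)
          + (k * n x * Θ x * (a - 3) / τ x) * (pd μ τ x * eta μ ν) := by
      intro μ
      have h1 := (((hE.mul (hasPd_positionFrom (t₀ := t₀) μ)).1.hasPd.mul
        (hasPd_positionFrom (t₀ := t₀) ν)).add (hp.mul (hasPd_const (eta μ ν)))).2 μ
      refine (pd_congr hU hx (fun y hy => ?_) μ).trans (h1.trans ?_)
      · rw [energyTensor, (hM y hy).2]
        simp only [Pi.smul_apply, smul_eq_mul, ← hτdef]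
        have h0 := (hpos y hy).ne'
        field_simp
        linear_combination (n y * positionFrom t₀ y μ * positionFrom t₀ y ν *
          (1 + (cv + k) * Θ y)) * hσ
      · beta_reduce
        ring
    simp only [hT]
    rw [Finset.sum_add_distrib, Finset.sum_add_distrib, ← Finset.sum_mul, ← Finset.mul_sum,
      sum_pd_mul_positionFrom hσ (hM x hx).1 hE]
    have h2 : ∑ μ, pd μ τ x * eta μ ν = -positionFrom t₀ x ν / τ x := by
      rw [Finset.sum_eq_single ν (fun b _ hb => by simp [eta_apply b ν, hb]) (by simp),
        (hasPd_properTime hσ (hM x hx).1).2]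
      beta_reduce
      rw [← hτdef]
      linear_combination (-positionFrom t₀ x ν / τ x) * eta_self_mul_self ν
    rw [h2]
    simp only [mul_ite, mul_one, mul_zero, Finset.sum_ite_eq', Finset.mem_univ, if_true, ← hτdef]
    -- The remaining terms, all multiples of the position vector, balance because (c_v + k) a = k (a
    -- - 3), that is, c_v a = -3k.
    rw [ha]
    field_simp
    ring
  · intro x hx
    have h0 := (hpos x hx).ne'
    have hf : HasPd (fun y => n y * (σ * (τ y)⁻¹))
        (fun μ => (-4 * σ * n x * (τ x ^ 2)⁻¹) * pd μ τ x) x := by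
      have h1 := (hnd x hx).mul (((hτ x hx).inv h0).const_mul σ)
      convert h1 using 2
      field_simp
      ring
    have h1 := sum_pd_mul_positionFrom hσ (hM x hx).1 hf
    have h2 : divergence (fun y => n y • u y) x =
        ∑ μ, pd μ (fun y => n y * (σ * (τ y)⁻¹) * positionFrom t₀ y μ) x :=
      Finset.sum_congr rfl fun μ _ => pd_congr hU hx (fun y hy => by
        simp only [(hM y hy).2, Pi.smul_apply, smul_eq_mul, ← hτdef]; ring) μ
    rw [h2, h1, ← hτdef]
    field_simp
    ring
  · intro x hx μ
    have h0 := (hpos x hx).ne'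
    have h1 := (hnd x hx).inv (hnpos x hx).ne'
    rw [(hasPd_const 0).2, ((hΘd x hx).const_mul cv).2, h1.2, ha]
    have h3 := (hnpos x hx).ne'
    field_simp
    ring
  · intro x hx
    exact mul_pos (mul_pos hk (hnpos x hx)) (hΘpos x hx)

end

/-! ### Signs, light cones and the equivalence. -/

section

variable {u : Spacetime → Fin 4 → ℝ} {U : Set Spacetime} {t₀ σ : ℝ} {x : Spacetime}

/-- Normalisation reads H² τ² = 1, so τ = 1/(σH); future direction then decides between the two
cones. -/
lemma isSignedMilne_of_eq_smul_positionFrom (hσ : σ ^ 2 = 1) (hu : IsUnitVelocity u U)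
    {H : Spacetime → ℝ} (h : ∀ x ∈ U, u x = H x • positionFrom t₀ x)
    (hH : ∀ x ∈ U, 0 < σ * H x) : IsSignedMilne σ t₀ u U := by
  intro x hx
  obtain ⟨hm, h0⟩ := hu.2 x hx
  have hpos := hH x hx
  have hq : H x ^ 2 * ((x 0 - t₀) ^ 2 - radius x ^ 2) = 1 := by
    have e : metric (u x) (u x) =
        H x ^ 2 * ∑ μ, eta μ μ * positionFrom t₀ x μ * positionFrom t₀ x μ := by
      rw [h x hx, metric_eq, Finset.mul_sum]
      exact Finset.sum_congr rfl fun μ _ => by simp only [Pi.smul_apply, smul_eq_mul]; ring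
    rw [sum_positionFrom_sq, hm] at e
    linarith
  have ht : 0 < σ * (x 0 - t₀) := by
    rw [h x hx] at h0
    have h1 : 0 < H x * (x 0 - t₀) := by simpa [positionFrom] using h0
    have h2 : 0 < (σ * H x) * (σ * (x 0 - t₀)) := by
      have e : (σ * H x) * (σ * (x 0 - t₀)) = σ ^ 2 * (H x * (x 0 - t₀)) := by ring
      rw [e, hσ, one_mul]
      exact h1
    exact pos_of_mul_pos_right h2 hpos.le
  have hτ : properTime t₀ x = (σ * H x)⁻¹ := by
    rw [properTime, ← Real.sqrt_sq (inv_pos.2 hpos).le]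
    congr 1
    rw [inv_pow, mul_pow, hσ, one_mul]
    exact eq_inv_of_mul_eq_one_right hq
  refine ⟨?_, ?_⟩
  · have hlt : radius x ^ 2 < (σ * (x 0 - t₀)) ^ 2 := by
      rw [mul_pow, hσ, one_mul]
      by_contra hle
      have : H x ^ 2 * ((x 0 - t₀) ^ 2 - radius x ^ 2) ≤ 0 :=
        mul_nonpos_of_nonneg_of_nonpos (sq_nonneg _) (by linarith)
      linarith
    exact lt_of_pow_lt_pow_left₀ 2 ht.le hlt
  · rw [h x hx, hτ, inv_inv, ← mul_assoc, ← pow_two, hσ, one_mul]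

lemma pos_or_neg_of_ne_zero {f : Spacetime → ℝ} (hconn : IsPreconnected U)
    (hf : ContinuousOn f U) (h0 : ∀ x ∈ U, f x ≠ 0) :
    (∀ x ∈ U, 0 < f x) ∨ ∀ x ∈ U, f x < 0 := by
  by_contra! hcon
  obtain ⟨⟨a, ha, ha'⟩, b, hb, hb'⟩ := hcon
  obtain ⟨c, hc, hc'⟩ := hconn.intermediate_value ha hb hf ⟨ha', hb'⟩
  exact h0 c hc hc'

lemma IsSignedMilne.characterization (hU : IsOpen U) (hσ : σ ^ 2 = 1)
    (hM : IsSignedMilne σ t₀ u U) :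
    IsRadialConformallyStationary u U ∧ (∀ x ∈ U, 0 < σ * expansion u x) ∧ IsCIGFlow u U := by
  refine ⟨hM.isRadialConformallyStationary hσ, fun x hx => ?_, 1, 1, ?_⟩
  · have hp := hM.properTime_pos hσ hx
    have e : σ * expansion u x = 3 / properTime t₀ x := by
      rw [hM.expansion_eq hU hσ hx]
      linear_combination (3 / properTime t₀ x) * hσ
    rw [e]
    positivity
  · obtain ⟨ρ, p, n, ε, s, Θ, h, -⟩ :=
      hM.isClassicalIdealGas hU hσ (zero_lt_one (α := ℝ)) (zero_lt_one (α := ℝ))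
    exact ⟨ρ, p, n, ε, s, Θ, h⟩

lemma exists_isSignedMilne_iff (hU : IsOpen U) (hconn : IsPreconnected U) (hσ : σ ^ 2 = 1) :
    (IsRadialConformallyStationary u U ∧ (∀ x ∈ U, 0 < σ * expansion u x) ∧ IsCIGFlow u U) ↔
      ∃ t₀ : ℝ, IsSignedMilne σ t₀ u U := by
  refine ⟨fun ⟨hr, hθ, hg⟩ => ?_, fun ⟨t₀, hM⟩ => hM.characterization hU hσ⟩
  rcases U.eq_empty_or_nonempty with rfl | hne
  · exact ⟨0, fun x hx => absurd hx (Set.notMem_empty x)⟩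
  obtain ⟨t₀, h⟩ := exists_eq_smul_positionFrom hU hconn hne hr
    (fun x hx => right_ne_zero_of_mul (hθ x hx).ne') hg
  refine ⟨t₀, isSignedMilne_of_eq_smul_positionFrom hσ hr.1 h fun x hx => ?_⟩
  have := hθ x hx
  linarith

end

end Minkowski

end

theorem mainTheorem11 (U : Set Spacetime) (hU : IsOpen U) (hconn : IsPreconnected U)
    (u : Spacetime → Fin 4 → ℝ) :
    ((Minkowski.IsRadialConformallyStationary u U ∧ (∀ x ∈ U, 0 < Minkowski.expansion u x) ∧
        Minkowski.IsCIGFlow u U) ↔ ∃ t₀ : ℝ, Minkowski.IsMilne t₀ u U) ∧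
    ((Minkowski.IsRadialConformallyStationary u U ∧ (∀ x ∈ U, Minkowski.expansion u x ≠ 0) ∧
        Minkowski.IsCIGFlow u U) ↔
      ((∃ t₀ : ℝ, Minkowski.IsMilne t₀ u U) ∨
        ∃ t₀ : ℝ, Minkowski.IsContractingMilne t₀ u U)) ∧
    (((∃ t₀ : ℝ, Minkowski.IsMilne t₀ u U) ∨ ∃ t₀ : ℝ, Minkowski.IsContractingMilne t₀ u U) →
      ∀ k cv : ℝ, 0 < k → 0 < cv → ∃ ρ p n ε s Θ : Spacetime → ℝ,
        Minkowski.IsClassicalIdealGas k cv u ρ p n ε s Θ U ∧ ∀ x ∈ U, 0 < n x ∧ 0 < Θ x) := by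
  
  have h1 := Minkowski.exists_isSignedMilne_iff (u := u) hU hconn (one_pow 2 : (1 : ℝ) ^ 2 = 1)
  have h2 := Minkowski.exists_isSignedMilne_iff (u := u) hU hconn
    (neg_one_sq : (-1 : ℝ) ^ 2 = 1)
  simp only [Minkowski.isSignedMilne_one, one_mul] at h1
  simp only [Minkowski.isSignedMilne_neg_one, neg_one_mul, Left.neg_pos_iff] at h2
  refine ⟨h1, ⟨fun ⟨hr, hθ, hg⟩ => ?_, ?_⟩, ?_⟩
  -- A continuous expansion without zeros has one sign on a connected set, which reduces to the
  -- signed equivalences.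
  · have hc := (Minkowski.contDiffOn_expansion hU hr.1.1).continuousOn
    rcases Minkowski.pos_or_neg_of_ne_zero hconn hc hθ with h | h
    · exact Or.inl (h1.1 ⟨hr, h, hg⟩)
    · exact Or.inr (h2.1 ⟨hr, h, hg⟩)
  · rintro (h | h)
    · obtain ⟨hr, hθ, hg⟩ := h1.2 h
      exact ⟨hr, fun x hx => (hθ x hx).ne', hg⟩
    · obtain ⟨hr, hθ, hg⟩ := h2.2 h
      exact ⟨hr, fun x hx => (hθ x hx).ne, hg⟩
  · rintro (⟨t₀, h⟩ | ⟨t₀, h⟩) k cv hk hcv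
    · exact (Minkowski.isSignedMilne_one.2 h).isClassicalIdealGas hU (one_pow 2) hk hcv
    · exact (Minkowski.isSignedMilne_neg_one.2 h).isClassicalIdealGas hU neg_one_sq hk hcv
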